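/- Let $n\ge 1$, let $\Omega\subset\mathbb R^n$ be a bounded open set containing $0$, let $R=\sup_{x\in\Omega}|x|$, and let $B=B_R(0)$. Let $V:(0,R]\to(0,\infty)$ be continuous and $C^1$ on $(0,R)$, write $V(x)=V(|x|)$, and assume that for some real $\lambda\le n-2$ $$\frac{rV_r(r)}{V(r)}+\lambda\ge 0\ \text{ on }(0,R),\qquad \lim_{r\to0}\Big(\frac{rV_r(r)}{V(r)}+\lambda\Big)=0 .$$ For a continuous $W\ge 0$ on $(0,R)$ and $c\in\mathbb R$ consider the equation $$(\mathrm B_{cW})\qquad y''(r)+\frac1r\,y'(r)+cW(r)y(r)=0 .$$ $W$ is called a Bessel potential on $(0,R)$ if $(\mathrm B_{cW})$ has a positive solution on $(0,R)$ for some $c>0$, and its weight is $\beta(W;R)=\sup\{c:\ (\mathrm B_{cW})\text{ has a positive solution on }(0,R)\}$ (if $W\equiv0$, terms containing $\beta(W;R)W$ are read as $0$). By a positive solution on $(0,R]$ we mean a positive solution on $(0,R)$ that is $C^1$ on $(0,R]$ and positive at $R$. Let $W$ be a Bessel potential on $(0,R)$. Let $u\in H^1(\Omega)$ be such that its extension by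 zero belongs to $H^1(B)$; this is every $u\in H^1(\Omega)$ if $\Omega=B$, and includes every $u\in H^1_0(\Omega)$ in general. Write $\int_{\partial B}u^2$ for the surface integral of the square of the trace of this extension on $\partial B$. Integrals over $\Omega$ are taken in $[0,\infty]$, with $0\cdot\infty=0$. (i) If $\varphi$ is a positive solution on $(0,R]$ of $(\mathrm B_{\beta(W;R)W})$, then $$\int_\Omega V|\nabla u|^2dx\ \ge\ \Big(\frac{n-\lambda-2}2\Big)^2\int_\Omega\frac{V}{|x|^2}u^2dx+\beta(W;R)\int_\Omega VW u^2dx+V(R)\Big(\frac{\varphi'(R)}{\varphi(R)}-\frac{n-\lambda-2}{2R}\Big)\int_{\partial B}u^2 .$$ (ii) More generally, if $c\ge0$ and $\varphi$ is a positive solution on $(0,R]$ of $(\mathrm B_{cW})$, then the inequality in (i) holds with $c$ in place of $\beta(W;R)$. (iii) If the trace of $u$ on $\partial B$ is zero (in particular if $u\in H^1_0(\Omega)$), then $$\int_\Omega V|\nabla u|^2dx\ \ge\ \Big(\frac{n-\lambda-2}2\Big)^2\int_\Omega\frac{V}{|x|^2}u^2dx+\beta(W;R)\int_\Omega VW u^2dx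 .$$ -/

import Mathlib

open Set Filter Topology MeasureTheory

noncomputable section

/-- `G` is the weak gradient of `u` on the open set `Ω`. -/
def IsWeakGradient {n : ℕ} (Ω : Set (EuclideanSpace ℝ (Fin n)))
    (u : EuclideanSpace ℝ (Fin n) → ℝ)
    (G : EuclideanSpace ℝ (Fin n) → EuclideanSpace ℝ (Fin n)) : Prop :=
  ∀ η : EuclideanSpace ℝ (Fin n) → ℝ,
    ContDiff ℝ ((⊤ : ℕ∞) : WithTop ℕ∞) η → HasCompactSupport η → tsupport η ⊆ Ω →
      ∫ x in Ω, u x • gradient η x = - ∫ x in Ω, η x • G x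

/-- `u` belongs to the Sobolev space `H¹(Ω)` and `G` is its weak gradient. -/
structure MemH1 {n : ℕ} (Ω : Set (EuclideanSpace ℝ (Fin n)))
    (u : EuclideanSpace ℝ (Fin n) → ℝ)
    (G : EuclideanSpace ℝ (Fin n) → EuclideanSpace ℝ (Fin n)) : Prop where
  memLp : MemLp u 2 (volume.restrict Ω)
  memLp_grad : MemLp G 2 (volume.restrict Ω)
  weakGradient : IsWeakGradient Ω u G

/-- The surface measure `ds` of the sphere of radius `R` centred at `0`, as a measure on `ℝⁿ`
(the image of the surface measure of the unit sphere under `ω ↦ R ω`, times `R ^ (n - 1)`). -/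
def surfaceMeasure (n : ℕ) (R : ℝ) : Measure (EuclideanSpace ℝ (Fin n)) :=
  ENNReal.ofReal (R ^ (n - 1)) •
    Measure.map
      (fun ω : Metric.sphere (0 : EuclideanSpace ℝ (Fin n)) 1 =>
        R • (ω : EuclideanSpace ℝ (Fin n)))
      (volume : Measure (EuclideanSpace ℝ (Fin n))).toSphere

/-- `T` is the trace on `∂B`, where `B` is the ball of radius `R` centred at `0`, of the
`H¹(B)`-function `u` with weak gradient `G`: the trace operator is the continuous extension of the
restriction `w ↦ w|_{∂B}` from functions smooth up to the boundary, so `T` is the `L²(∂B)`-limit of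
the boundary values of smooth functions that converge to `u` in `H¹(B)`. -/
def IsTrace {n : ℕ} (R : ℝ) (u : EuclideanSpace ℝ (Fin n) → ℝ)
    (G : EuclideanSpace ℝ (Fin n) → EuclideanSpace ℝ (Fin n))
    (T : EuclideanSpace ℝ (Fin n) → ℝ) : Prop :=
  MemLp T 2 (surfaceMeasure n R) ∧
  ∃ w : ℕ → EuclideanSpace ℝ (Fin n) → ℝ,
    (∀ k, ContDiff ℝ ((⊤ : ℕ∞) : WithTop ℕ∞) (w k)) ∧
    Tendsto (fun k => eLpNorm (fun x => w k x - u x) 2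
      (volume.restrict (Metric.ball (0 : EuclideanSpace ℝ (Fin n)) R))) atTop (𝓝 0) ∧
    Tendsto (fun k => eLpNorm (fun x => gradient (w k) x - G x) 2
      (volume.restrict (Metric.ball (0 : EuclideanSpace ℝ (Fin n)) R))) atTop (𝓝 0) ∧
    Tendsto (fun k => eLpNorm (fun x => w k x - T x) 2 (surfaceMeasure n R)) atTop (𝓝 0)

/-- `φ` is a positive (`C²`) solution on `(0, R)` of `y'' + y' / r + c W y = 0`. -/
structure IsPosBesselSolution (R c : ℝ) (W φ : ℝ → ℝ) : Prop where
  contDiffOn : ContDiffOn ℝ 2 φ (Ioo 0 R)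
  pos : ∀ r ∈ Ioo 0 R, 0 < φ r
  ode : ∀ r ∈ Ioo 0 R, deriv (deriv φ) r + deriv φ r / r + c * W r * φ r = 0

/-- `φ` is a positive solution of `y'' + y' / r + c W y = 0` on `(0, R]`: a solution on `(0, R)`
which is `C¹` up to `R` and positive at `R` too, so that `φ'(R) / φ(R)` makes sense. -/
structure IsPosBesselSolutionUpTo (R c : ℝ) (W φ : ℝ → ℝ) : Prop
    extends IsPosBesselSolution R c W φ where
  contDiffOn_Ioc : ContDiffOn ℝ 1 φ (Ioc 0 R)
  pos_right : 0 < φ R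

/-- `W` is a Bessel potential on `(0, R)`. -/
structure IsBesselPotential (R : ℝ) (W : ℝ → ℝ) : Prop where
  continuousOn : ContinuousOn W (Ioo 0 R)
  nonneg : ∀ r ∈ Ioo 0 R, 0 ≤ W r
  exists_solution : ∃ c : ℝ, 0 < c ∧ ∃ φ : ℝ → ℝ, IsPosBesselSolution R c W φ

/-- The weight `β(W; R)` of a Bessel potential. The set is non-empty (`c = 0`, `φ = 1`), and it is
bounded above unless `W` vanishes identically on `(0, R)`; in that case the value does not matter
below, where `β(W; R)` is multiplied by `W`. -/
def besselWeight (R : ℝ) (W : ℝ → ℝ) : ℝ :=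
  sSup {c : ℝ | ∃ φ : ℝ → ℝ, IsPosBesselSolution R c W φ}

/-- `∫_Ω V(|x|) |G(x)|² dx`, a number in `[0, ∞]`. -/
def weightedEnergy {n : ℕ} (Ω : Set (EuclideanSpace ℝ (Fin n))) (V : ℝ → ℝ)
    (G : EuclideanSpace ℝ (Fin n) → EuclideanSpace ℝ (Fin n)) : ENNReal :=
  ∫⁻ x in Ω, ENNReal.ofReal (V ‖x‖ * ‖G x‖ ^ 2)

/-- `∫_Ω P(|x|) u(x)² dx`, a number in `[0, ∞]`. -/
def weightedMass {n : ℕ} (Ω : Set (EuclideanSpace ℝ (Fin n))) (P : ℝ → ℝ)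
    (u : EuclideanSpace ℝ (Fin n) → ℝ) : ENNReal :=
  ∫⁻ x in Ω, ENNReal.ofReal (P ‖x‖ * u x ^ 2)

end

/-!
Let `α = (n - λ - 2) / 2 ≥ 0`. The comparison function `h(r) = r ^ (-α) φ(r)` is a positive
supersolution of the radial Euler equation of the inequality. In Riccati form, the function
`K = - r ^ (n - 1) V h' / h` satisfies `K' ≥ r ^ (n - 1) V (α² / r² + c W) + K² / (r ^ (n - 1) V)`
(`bessel_lintegral_le`), and completing a square on each ray gives the inequality between two radii,
with the boundary terms `K g²` at both ends (`riccati_lintegral_le`). A positive solution `φ` is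
concave as a function of `log r`, hence nonincreasing (`IsPosBesselSolution.deriv_nonpos`), since a
concave function that is positive near `log r = -∞` cannot increase. So `K ≥ 0`: the boundary term
at the inner radius has the right sign and is dropped, whatever the behaviour at the origin.

Integration over the unit sphere gives the inequality on annuli for smooth functions
(`annulus_lintegral_le`). Since the trace is defined through smooth approximations in `H¹(B)` with
convergent boundary values, and since `V` is bounded away from the origin, the inequality passes to
the limit, by Fatou's lemma on the left-hand side; afterwards the inner radius tends to `0`
(`lintegral_le_of_isTrace`). A solution that is positive up to `R` then gives the inequality with
boundary term (`bessel_trace_inequality`).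

For functions with zero trace nothing is known of `φ` at `R`. There `c W` is cut off at `ρ < R`, the
solution `φ` is replaced by `φ + ε`, and it is continued beyond `ρ` by its tangent in the variable
`log r`. By concavity the tangent stays above `φ + ε`, so this is a comparison function that is
positive up to `R` (`IsPosBesselSolution.exists_truncated_lintegral_le`); its boundary term vanishes
with the trace. Fatou's lemma for `ρ → R` and `ε → 0` gives the inequality for every `c` that admits
a positive solution, and `β(W; R)` is a limit of such `c`.
-/

/-! ### The Riccati inequality on an interval -/

/-- The square completion behind every inequality of this file: if `K' ≥ p + K² / v`, then
`(- K g²)' ≤ v g'² - p g²`, because the difference of the two sides is at least `v (g' + K g / v)²`. -/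
theorem riccati_energy_le {a s : ℝ} (has : a ≤ s) {v p K K' g : ℝ → ℝ}
    (hv : ContinuousOn v (Icc a s)) (hvpos : ∀ r ∈ Ioo a s, 0 < v r)
    (hp : ContinuousOn p (Icc a s)) (hK : ContinuousOn K (Icc a s))
    (hK' : ∀ r ∈ Ioo a s, HasDerivAt K (K' r) r)
    (hric : ∀ r ∈ Ioo a s, p r + K r ^ 2 / v r ≤ K' r) (hg : ContDiff ℝ 1 g) :
    K a * g a ^ 2 + ∫ r in a..s, p r * g r ^ 2 ≤
      (∫ r in a..s, v r * deriv g r ^ 2) + K s * g s ^ 2 := by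
  have hgc : Continuous g := hg.continuous
  have hgd : Continuous (deriv g) := hg.continuous_deriv le_rfl
  have h1 : ContinuousOn (fun r => p r * g r ^ 2) (Icc a s) :=
    hp.mul (hgc.pow 2).continuousOn
  have h2 : ContinuousOn (fun r => v r * deriv g r ^ 2) (Icc a s) :=
    hv.mul (hgd.pow 2).continuousOn
  have hmain := intervalIntegral.sub_le_integral_of_hasDeriv_right_of_le has
    (g := fun r => - (K r * g r ^ 2))
    (g' := fun r => - (K' r * g r ^ 2 + K r * (2 * g r * deriv g r)))
    (φ := fun r => v r * deriv g r ^ 2 - p r * g r ^ 2)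
    (hK.mul (hgc.pow 2).continuousOn).neg
    (fun r hr => by
      have hgr : HasDerivAt g (deriv g r) r :=
        (hg.differentiable one_ne_zero r).hasDerivAt
      have := ((hK' r hr).mul (hgr.pow 2)).neg.hasDerivWithinAt (s := Ioi r)
      exact this.congr_deriv (by simp))
    (h2.sub h1).integrableOn_Icc
    (fun r hr => by
      have hvr := hvpos r hr
      -- completing the square
      have hsq : 0 ≤ v r * (deriv g r + K r / v r * g r) ^ 2 := by positivity
      have hexp : v r * (deriv g r + K r / v r * g r) ^ 2
          = v r * deriv g r ^ 2 + 2 * K r * g r * deriv g r + K r ^ 2 / v r * g r ^ 2 := by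
        field_simp
        ring
      have := mul_le_mul_of_nonneg_right (hric r hr) (sq_nonneg (g r))
      nlinarith)
  rw [intervalIntegral.integral_sub
    (h2.intervalIntegrable_of_Icc has) (h1.intervalIntegrable_of_Icc has)] at hmain
  linarith

theorem lintegral_Ioo_eq_ofReal_intervalIntegral {a s : ℝ} (has : a ≤ s) {f : ℝ → ℝ}
    (hf : ContinuousOn f (Icc a s)) (h0 : ∀ r ∈ Ioo a s, 0 ≤ f r) :
    ∫⁻ r in Ioo a s, ENNReal.ofReal (f r) = ENNReal.ofReal (∫ r in a..s, f r) := by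
  rw [intervalIntegral.integral_of_le has, ← integral_Ioc_eq_integral_Ioo.symm,
    ofReal_integral_eq_lintegral_ofReal]
  · exact hf.integrableOn_Icc.mono_set Ioo_subset_Icc_self
  · exact (ae_restrict_iff' measurableSet_Ioo).2 (Eventually.of_forall h0)

theorem integral_Ioo_nonneg {a s : ℝ} (has : a ≤ s) {f : ℝ → ℝ}
    (h0 : ∀ r ∈ Ioo a s, 0 ≤ f r) : 0 ≤ ∫ r in a..s, f r := by
  rw [intervalIntegral.integral_of_le has, integral_Ioc_eq_integral_Ioo]
  exact setIntegral_nonneg measurableSet_Ioo h0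

/-- The form of `riccati_energy_le` with values in `[0, ∞]`. Here `p` may be unbounded near `b`: the
inequality is applied on `[a, s]` and `s` tends to `b`. The term at `a` is kept, so that inequalities
on adjacent intervals can be added. -/
theorem riccati_lintegral_le {a b : ℝ} (hab : a < b) {v p K K' g : ℝ → ℝ}
    (hv : ContinuousOn v (Icc a b)) (hvpos : ∀ r ∈ Ioo a b, 0 < v r)
    (hp : ContinuousOn p (Ico a b)) (hp0 : ∀ r ∈ Ioo a b, 0 ≤ p r)
    (hK : ContinuousOn K (Icc a b)) (hK0 : ∀ r ∈ Ico a b, 0 ≤ K r)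
    (hK' : ∀ r ∈ Ioo a b, HasDerivAt K (K' r) r)
    (hric : ∀ r ∈ Ioo a b, p r + K r ^ 2 / v r ≤ K' r) (hg : ContDiff ℝ 1 g) :
    ENNReal.ofReal (K a * g a ^ 2) + ∫⁻ r in Ioo a b, ENNReal.ofReal (p r * g r ^ 2) ≤
      (∫⁻ r in Ioo a b, ENNReal.ofReal (v r * deriv g r ^ 2)) +
        ENNReal.ofReal (K b * g b ^ 2) := by
  have hgc : Continuous g := hg.continuous
  have hgd : Continuous (deriv g) := hg.continuous_deriv le_rfl
  have hKa : 0 ≤ K a := hK0 a ⟨le_rfl, hab⟩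
  have hmem : ∀ᶠ s in 𝓝[<] b, s ∈ Ioo a b := Ioo_mem_nhdsLT hab
  have hs : ∀ᶠ s in 𝓝[<] b,
      ENNReal.ofReal (K a * g a ^ 2) + ∫⁻ r in Ioo a s, ENNReal.ofReal (p r * g r ^ 2) ≤
      (∫⁻ r in Ioo a b, ENNReal.ofReal (v r * deriv g r ^ 2)) +
        ENNReal.ofReal (K s * g s ^ 2) := by
    filter_upwards [hmem] with s hs
    have hsub : Ioo a s ⊆ Ioo a b := Ioo_subset_Ioo_right hs.2.le
    have hIcc : Icc a s ⊆ Icc a b := Icc_subset_Icc_right hs.2.le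
    have hIco : Icc a s ⊆ Ico a b := Icc_subset_Ico_right hs.2
    have key := riccati_energy_le hs.1.le (hv.mono hIcc) (fun r hr => hvpos r (hsub hr))
      (hp.mono hIco) (hK.mono hIcc) (fun r hr => hK' r (hsub hr))
      (fun r hr => hric r (hsub hr)) hg
    have h1 : ∀ r ∈ Ioo a s, 0 ≤ p r * g r ^ 2 := fun r hr =>
      mul_nonneg (hp0 r (hsub hr)) (sq_nonneg _)
    have h2 : ∀ r ∈ Ioo a s, 0 ≤ v r * deriv g r ^ 2 := fun r hr =>
      mul_nonneg (hvpos r (hsub hr)).le (sq_nonneg _)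
    have e1 := lintegral_Ioo_eq_ofReal_intervalIntegral hs.1.le (f := fun r => p r * g r ^ 2)
      ((hp.mono hIco).mul (hgc.pow 2).continuousOn) h1
    have e2 := lintegral_Ioo_eq_ofReal_intervalIntegral hs.1.le
      (f := fun r => v r * deriv g r ^ 2)
      ((hv.mono hIcc).mul (hgd.pow 2).continuousOn) h2
    have n2 : 0 ≤ K s * g s ^ 2 := mul_nonneg (hK0 s ⟨hs.1.le, hs.2⟩) (sq_nonneg _)
    calc _ ≤ (∫⁻ r in Ioo a s, ENNReal.ofReal (v r * deriv g r ^ 2)) +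
        ENNReal.ofReal (K s * g s ^ 2) := by
          rw [e1, e2, ← ENNReal.ofReal_add (by positivity) (integral_Ioo_nonneg hs.1.le h1),
            ← ENNReal.ofReal_add (integral_Ioo_nonneg hs.1.le h2) n2]
          exact ENNReal.ofReal_le_ofReal key
      _ ≤ _ := by
          gcongr
  have hcover : AECover (volume.restrict (Ioo a b)) (𝓝[<] b) (fun s => Ioo a s) :=
    aecover_Ioo_of_Ioo tendsto_const_nhds (tendsto_id.mono_left nhdsWithin_le_nhds)
  have hlim1 : Tendsto (fun s => ∫⁻ r in Ioo a s, ENNReal.ofReal (p r * g r ^ 2)) (𝓝[<] b)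
      (𝓝 (∫⁻ r in Ioo a b, ENNReal.ofReal (p r * g r ^ 2))) := by
    have := hcover.lintegral_tendsto_of_countably_generated
      (f := fun r => ENNReal.ofReal (p r * g r ^ 2))
      (((hp.mono Ioo_subset_Ico_self).mul
        (hgc.pow 2).continuousOn).aemeasurable measurableSet_Ioo).ennreal_ofReal
    refine this.congr' ?_
    filter_upwards [hmem] with s hs
    rw [Measure.restrict_restrict measurableSet_Ioo,
      inter_eq_self_of_subset_left (Ioo_subset_Ioo_right hs.2.le)]
  have hlim2 : Tendsto (fun s => ENNReal.ofReal (K s * g s ^ 2)) (𝓝[<] b)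
      (𝓝 (ENNReal.ofReal (K b * g b ^ 2))) := by
    refine (ENNReal.continuous_ofReal.tendsto _).comp (Tendsto.mul ?_ ?_)
    · exact ((hK b ⟨hab.le, le_rfl⟩).mono_of_mem_nhdsWithin
        (mem_of_superset (Ioo_mem_nhdsLT hab) Ioo_subset_Icc_self))
    · exact ((hgc.pow 2).tendsto b).mono_left nhdsWithin_le_nhds
  exact le_of_tendsto_of_tendsto (tendsto_const_nhds.add hlim1) (tendsto_const_nhds.add hlim2) hs

/-! ### Positive solutions of the Bessel equation -/

/-- The function `K = r ^ (n - 1) * V * (α / r - ψ' / ψ)`, which solves the Riccati inequality of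
`riccati_lintegral_le`. It is `- r ^ (n - 1) * V` times the logarithmic derivative of the comparison
function `r ^ (-α) * ψ`. The derivative of `ψ` is passed as a separate function `dψ`, which may be
one-sided at an end point. -/
noncomputable def besselFlux (n : ℕ) (α : ℝ) (V ψ dψ : ℝ → ℝ) (r : ℝ) : ℝ :=
  r ^ (n - 1) * V r * (α / r - dψ r / ψ r)

theorem hasDerivAt_besselFlux {n : ℕ} {α r V' ddψ : ℝ} {V ψ dψ : ℝ → ℝ} (hn : 1 ≤ n)
    (hr : 0 < r) (hψ : 0 < ψ r) (hV : HasDerivAt V V' r) (hdψ : HasDerivAt ψ (dψ r) r)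
    (hddψ : HasDerivAt dψ ddψ r) :
    HasDerivAt (besselFlux n α V ψ dψ)
      (r ^ (n - 1) * (((n : ℝ) - 1) / r * V r + V') * (α / r - dψ r / ψ r) +
        r ^ (n - 1) * V r * (-α / r ^ 2 - ddψ / ψ r + (dψ r / ψ r) ^ 2)) r := by
  have hpow : HasDerivAt (fun r : ℝ => r ^ (n - 1)) (r ^ (n - 1) * (((n : ℝ) - 1) / r)) r := by
    refine (hasDerivAt_pow (n - 1) r).congr_deriv ?_
    obtain ⟨m, rfl⟩ := Nat.exists_eq_add_of_le hn
    -- For `n = 1` the derivative formula contains the truncated exponent `0 - 1`.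
    rcases m with _ | m
    · simp
    · have : 1 + (m + 1) - 1 = m + 1 := by omega
      rw [this]
      simp only [Nat.add_sub_cancel]
      push_cast
      field_simp
      ring
  have hinv : HasDerivAt (fun r : ℝ => α / r) (-α / r ^ 2) r := by
    have := (hasDerivAt_inv hr.ne').const_mul α
    refine (this.congr_deriv (by field_simp)).congr_of_eventuallyEq ?_
    exact Eventually.of_forall fun x => div_eq_mul_inv _ _
  refine ((hpow.mul hV).mul (hinv.sub (hddψ.div hdψ hψ.ne'))).congr_deriv ?_
  simp only [Pi.mul_apply, Pi.sub_apply, Pi.div_apply]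
  field_simp
  ring

/-- A positive nonincreasing solution of `ψ'' + ψ' / r + Q ψ = 0` gives a weighted one-dimensional
Hardy inequality. With `α = (n - 2 - λ) / 2`, `besselFlux` satisfies the Riccati inequality for the weight
`v = r ^ (n - 1) V` and the potential `v (α² / r² + Q)`; there is equality up to the term
`r ^ (n - 1) (V' + λ V / r) (α / r - ψ' / ψ)`, a product of nonnegative factors. -/
theorem bessel_lintegral_le {n : ℕ} (hn : 1 ≤ n) {lam α : ℝ} (hα : 0 ≤ α)
    (hlam : 2 * α = (n : ℝ) - 2 - lam) {a b : ℝ} (ha : 0 < a) (hab : a < b)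
    {V ψ dψ Q : ℝ → ℝ} (hV : ContinuousOn V (Icc a b)) (hVpos : ∀ r ∈ Icc a b, 0 < V r)
    (hVdiff : ∀ r ∈ Ioo a b, DifferentiableAt ℝ V r)
    (hVlam : ∀ r ∈ Ioo a b, 0 ≤ r * deriv V r / V r + lam)
    (hψc : ContinuousOn ψ (Icc a b)) (hdψc : ContinuousOn dψ (Icc a b))
    (hψ : ∀ r ∈ Icc a b, 0 < ψ r) (hdψ : ∀ r ∈ Ico a b, dψ r ≤ 0)
    (hψ' : ∀ r ∈ Ioo a b, HasDerivAt ψ (dψ r) r)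
    (hode : ∀ r ∈ Ioo a b, HasDerivAt dψ (-dψ r / r - Q r * ψ r) r)
    (hQ : ContinuousOn Q (Ico a b)) (hQ0 : ∀ r ∈ Ioo a b, 0 ≤ Q r)
    {g : ℝ → ℝ} (hg : ContDiff ℝ 1 g) :
    ENNReal.ofReal (besselFlux n α V ψ dψ a * g a ^ 2) +
      ∫⁻ r in Ioo a b, ENNReal.ofReal (r ^ (n - 1) * (V r * (α ^ 2 / r ^ 2 + Q r)) * g r ^ 2) ≤
    (∫⁻ r in Ioo a b, ENNReal.ofReal (r ^ (n - 1) * V r * deriv g r ^ 2)) +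
      ENNReal.ofReal (besselFlux n α V ψ dψ b * g b ^ 2) := by
  have hpos : ∀ r ∈ Icc a b, 0 < r := fun r hr => ha.trans_le hr.1
  have hsub : Ico a b ⊆ Icc a b := Ico_subset_Icc_self
  have hsub' : Ioo a b ⊆ Icc a b := Ioo_subset_Icc_self
  have hflux : ∀ r ∈ Ico a b, 0 ≤ α / r - dψ r / ψ r := fun r hr => by
    have h1 : 0 ≤ α / r := div_nonneg hα (hpos r (hsub hr)).le
    have h2 : dψ r / ψ r ≤ 0 := div_nonpos_of_nonpos_of_nonneg (hdψ r hr) (hψ r (hsub hr)).le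
    linarith
  refine riccati_lintegral_le hab (v := fun r => r ^ (n - 1) * V r) ?_ ?_ ?_ ?_ ?_ ?_
    (fun r hr => hasDerivAt_besselFlux hn (hpos r (hsub' hr)) (hψ r (hsub' hr))
      (hVdiff r hr).hasDerivAt (hψ' r hr) (hode r hr)) ?_ hg
  · exact (continuous_pow _).continuousOn.mul hV
  · exact fun r hr => mul_pos (pow_pos (hpos r (hsub' hr)) _) (hVpos r (hsub' hr))
  · refine (continuous_pow _).continuousOn.mul ((hV.mono hsub).mul (ContinuousOn.add ?_ hQ))
    exact continuousOn_const.div (continuous_pow _).continuousOn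
      fun r hr => (pow_pos (hpos r (hsub hr)) _).ne'
  · intro r hr
    have := hpos r (hsub' hr)
    have := hVpos r (hsub' hr)
    have := hQ0 r hr
    positivity
  · refine ((continuous_pow _).continuousOn.mul hV).mul (ContinuousOn.sub ?_ ?_)
    · exact continuousOn_const.div continuousOn_id fun r hr => (hpos r hr).ne'
    · exact hdψc.div hψc fun r hr => (hψ r hr).ne'
  · intro r hr
    exact mul_nonneg (mul_nonneg (pow_pos (hpos r (hsub hr)) _).le (hVpos r (hsub hr)).le)
      (hflux r hr)
  · intro r hr
    have hr0 := hpos r (hsub' hr)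
    have hV0 := hVpos r (hsub' hr)
    have hψ0 := hψ r (hsub' hr)
    have hf := hflux r ⟨hr.1.le, hr.2⟩
    have hl := hVlam r hr
    have hrn : 0 < r ^ (n - 1) := pow_pos hr0 _
    set t := dψ r / ψ r with ht
    set ν := r ^ (n - 1) with hν
    have hV' : -lam / r * V r ≤ deriv V r := by
      have h := mul_nonneg hl (div_pos hV0 hr0).le
      have e : (r * deriv V r / V r + lam) * (V r / r) = deriv V r + lam / r * V r := by
        field_simp
      rw [e] at h
      have e2 : -lam / r * V r = -(lam / r * V r) := by ring
      linarith
    have hQt : (-dψ r / r - Q r * ψ r) / ψ r = - t / r - Q r := by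
      rw [ht]; field_simp
    have hK2 : besselFlux n α V ψ dψ r ^ 2 / (ν * V r) = ν * V r * (α / r - t) ^ 2 := by
      simp only [besselFlux, ← hν, ← ht]
      field_simp
    rw [hQt, hK2]
    -- Replacing `V'` by its lower bound `- λ V / r` turns the Riccati inequality into an identity.
    have hmul := mul_le_mul_of_nonneg_right (mul_le_mul_of_nonneg_left
      (add_le_add_right hV' (((n : ℝ) - 1) / r * V r)) hrn.le) hf
    refine le_trans (le_of_eq ?_) (add_le_add_left hmul _)
    have hn' : (n : ℝ) = 2 * α + 2 + lam := by linarith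
    rw [hn']
    field_simp
    ring

namespace IsPosBesselSolution

variable {R c : ℝ} {W φ : ℝ → ℝ}

theorem hasDerivAt (h : IsPosBesselSolution R c W φ) {r : ℝ} (hr : r ∈ Ioo 0 R) :
    HasDerivAt φ (deriv φ r) r :=
  ((h.contDiffOn.differentiableOn (by norm_num)).differentiableAt
    (isOpen_Ioo.mem_nhds hr)).hasDerivAt

theorem contDiffOn_deriv (h : IsPosBesselSolution R c W φ) :
    ContDiffOn ℝ 1 (deriv φ) (Ioo 0 R) :=
  h.contDiffOn.deriv_of_isOpen isOpen_Ioo (by norm_num)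

theorem hasDerivAt_deriv (h : IsPosBesselSolution R c W φ) {r : ℝ} (hr : r ∈ Ioo 0 R) :
    HasDerivAt (deriv φ) (-deriv φ r / r - c * W r * φ r) r := by
  have h1 := ((h.contDiffOn_deriv.differentiableOn (by norm_num)).differentiableAt
    (isOpen_Ioo.mem_nhds hr)).hasDerivAt
  refine h1.congr_deriv ?_
  have := h.ode r hr
  rw [neg_div]
  linarith

theorem hasDerivAt_mul_deriv (h : IsPosBesselSolution R c W φ) {r : ℝ} (hr : r ∈ Ioo 0 R) :
    HasDerivAt (fun r => r * deriv φ r) (-(r * (c * W r * φ r))) r := by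
  have := (hasDerivAt_id r).mul (h.hasDerivAt_deriv hr)
  refine this.congr_deriv ?_
  have := hr.1.ne'
  simp only [id]
  field_simp
  ring

theorem antitoneOn_mul_deriv (h : IsPosBesselSolution R c W φ) (hc : 0 ≤ c)
    (hW : ∀ r ∈ Ioo 0 R, 0 ≤ W r) : AntitoneOn (fun r => r * deriv φ r) (Ioo 0 R) := by
  refine antitoneOn_of_deriv_nonpos (convex_Ioo 0 R)
    (fun r hr => (h.hasDerivAt_mul_deriv hr).continuousAt.continuousWithinAt)
    (fun r hr => ?_) (fun r hr => ?_) <;> rw [interior_Ioo] at hr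
  · exact (h.hasDerivAt_mul_deriv hr).differentiableAt.differentiableWithinAt
  · rw [(h.hasDerivAt_mul_deriv hr).deriv]
    have h1 := hr.1
    have h2 := hW r hr
    have h3 := h.pos r hr
    have : 0 ≤ r * (c * W r * φ r) := by positivity
    linarith

/-- A positive solution is a concave function of `log r`, so it lies below its tangents. -/
theorem le_tangent (h : IsPosBesselSolution R c W φ) (hc : 0 ≤ c)
    (hW : ∀ r ∈ Ioo 0 R, 0 ≤ W r) {ρ r : ℝ} (hρ : ρ ∈ Ioo 0 R) (hr : r ∈ Ioo 0 R) :
    φ r ≤ φ ρ + ρ * deriv φ ρ * Real.log (r / ρ) := by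
  have hder : ∀ s ∈ Ioo 0 R, HasDerivAt (fun s => ρ * deriv φ ρ * Real.log s - φ s)
      ((ρ * deriv φ ρ - s * deriv φ s) / s) s := fun s hs => by
    refine (((Real.hasDerivAt_log hs.1.ne').const_mul (ρ * deriv φ ρ)).sub
      (h.hasDerivAt hs)).congr_deriv ?_
    have := hs.1.ne'
    field_simp
  have hanti := h.antitoneOn_mul_deriv hc hW
  rw [Real.log_div hr.1.ne' hρ.1.ne', mul_sub]
  rcases le_total ρ r with hle | hle
  · have hsub : Icc ρ r ⊆ Ioo 0 R := fun s hs => ⟨hρ.1.trans_le hs.1, hs.2.trans_lt hr.2⟩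
    have hmono : MonotoneOn (fun s => ρ * deriv φ ρ * Real.log s - φ s) (Icc ρ r) := by
      refine monotoneOn_of_deriv_nonneg (convex_Icc ρ r)
        (fun s hs => (hder s (hsub hs)).continuousAt.continuousWithinAt)
        (fun s hs => (hder s (hsub (interior_subset hs))).differentiableAt.differentiableWithinAt)
        (fun s hs => ?_)
      have hs' := interior_subset hs
      rw [(hder s (hsub hs')).deriv]
      exact div_nonneg (sub_nonneg.2 (hanti hρ (hsub hs') hs'.1)) (hsub hs').1.le
    have := hmono ⟨le_rfl, hle⟩ ⟨hle, le_rfl⟩ hle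
    simp only at this
    linarith
  · have hsub : Icc r ρ ⊆ Ioo 0 R := fun s hs => ⟨hr.1.trans_le hs.1, hs.2.trans_lt hρ.2⟩
    have hmono : AntitoneOn (fun s => ρ * deriv φ ρ * Real.log s - φ s) (Icc r ρ) := by
      refine antitoneOn_of_deriv_nonpos (convex_Icc r ρ)
        (fun s hs => (hder s (hsub hs)).continuousAt.continuousWithinAt)
        (fun s hs => (hder s (hsub (interior_subset hs))).differentiableAt.differentiableWithinAt)
        (fun s hs => ?_)
      have hs' := interior_subset hs
      rw [(hder s (hsub hs')).deriv]
      exact div_nonpos_of_nonpos_of_nonneg (sub_nonpos.2 (hanti (hsub hs') hρ hs'.2))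
        (hsub hs').1.le
    have := hmono ⟨le_rfl, hle⟩ ⟨hle, le_rfl⟩ hle
    simp only at this
    linarith

/-- A positive solution is nonincreasing: if `φ' ρ > 0`, the tangent at `ρ`, as a function of `log r`,
is negative for small `r`, and `φ` lies below it. -/
theorem deriv_nonpos (h : IsPosBesselSolution R c W φ) (hc : 0 ≤ c)
    (hW : ∀ r ∈ Ioo 0 R, 0 ≤ W r) {ρ : ℝ} (hρ : ρ ∈ Ioo 0 R) : deriv φ ρ ≤ 0 := by
  by_contra! hpos
  have hm : 0 < ρ * deriv φ ρ := mul_pos hρ.1 hpos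
  have hφ := h.pos ρ hρ
  -- the zero of the tangent at `ρ`
  have hr : ρ * Real.exp (-(φ ρ / (ρ * deriv φ ρ))) ∈ Ioo 0 R := by
    refine ⟨mul_pos hρ.1 (Real.exp_pos _), lt_of_le_of_lt ?_ hρ.2⟩
    refine mul_le_of_le_one_right hρ.1.le (Real.exp_le_one_iff.2 ?_)
    exact neg_nonpos.2 (div_pos hφ hm).le
  have h1 := h.le_tangent hc hW hρ hr
  rw [mul_div_cancel_left₀ _ hρ.1.ne', Real.log_exp, mul_neg, mul_div_cancel₀ _ hm.ne'] at h1
  linarith [h.pos _ hr]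

end IsPosBesselSolution

/-! ### Polar coordinates and annuli -/

/-- Integration in polar coordinates. -/
theorem lintegral_eq_lintegral_sphere_lintegral_Ioi {n : ℕ} (hn : 1 ≤ n)
    {f : EuclideanSpace ℝ (Fin n) → ENNReal} (hf : Measurable f) :
    ∫⁻ x, f x = ∫⁻ ω : Metric.sphere (0 : EuclideanSpace ℝ (Fin n)) 1,
      (∫⁻ r in Ioi (0 : ℝ), ENNReal.ofReal (r ^ (n - 1)) * f (r • (ω : EuclideanSpace ℝ (Fin n))))
        ∂(volume : Measure (EuclideanSpace ℝ (Fin n))).toSphere := by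
  have : Nonempty (Fin n) := ⟨⟨0, hn⟩⟩
  have hsmul : Measurable fun y : Metric.sphere (0 : EuclideanSpace ℝ (Fin n)) 1 × Ioi (0 : ℝ) =>
      f ((y.2 : ℝ) • (y.1 : EuclideanSpace ℝ (Fin n))) := hf.comp (by fun_prop)
  have hpres :=
    (volume : Measure (EuclideanSpace ℝ (Fin n))).measurePreserving_homeomorphUnitSphereProd
  have h1 := hpres.lintegral_comp hsmul
  have h2 : ∀ x : ({(0)}ᶜ : Set (EuclideanSpace ℝ (Fin n))),
      f (((homeomorphUnitSphereProd _ x).2 : ℝ) •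
        ((homeomorphUnitSphereProd _ x).1 : EuclideanSpace ℝ (Fin n))) = f x := fun x => by
    have hx : ‖(x : EuclideanSpace ℝ (Fin n))‖ ≠ 0 := norm_ne_zero_iff.2 x.2
    congr 1
    simp [smul_smul, hx]
  simp only [h2] at h1
  have h0 : ∫⁻ x, f x = ∫⁻ x : ({(0)}ᶜ : Set (EuclideanSpace ℝ (Fin n))), f x
      ∂((volume : Measure (EuclideanSpace ℝ (Fin n))).comap (↑)) := by
    rw [lintegral_subtype_comap (measurableSet_singleton _).compl, restrict_compl_singleton]
  rw [h0, h1, lintegral_prod _ hsmul.aemeasurable]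
  refine lintegral_congr fun ω => ?_
  rw [Measure.volumeIoiPow, lintegral_withDensity_eq_lintegral_mul _ (by fun_prop) (by fun_prop)]
  simp only [Pi.mul_apply, finrank_euclideanSpace, Fintype.card_fin]
  rw [lintegral_subtype_comap measurableSet_Ioi
    (fun r : ℝ => ENNReal.ofReal (r ^ (n - 1)) * f (r • (ω : EuclideanSpace ℝ (Fin n))))]

theorem setLIntegral_annulus {n : ℕ} (hn : 1 ≤ n) {a b : ℝ} (ha : 0 ≤ a)
    {f : EuclideanSpace ℝ (Fin n) → ENNReal} (hf : Measurable f) :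
    ∫⁻ x in {x | ‖x‖ ∈ Ioo a b}, f x = ∫⁻ ω : Metric.sphere (0 : EuclideanSpace ℝ (Fin n)) 1,
      (∫⁻ r in Ioo a b, ENNReal.ofReal (r ^ (n - 1)) * f (r • (ω : EuclideanSpace ℝ (Fin n))))
        ∂(volume : Measure (EuclideanSpace ℝ (Fin n))).toSphere := by
  have hS : MeasurableSet {x : EuclideanSpace ℝ (Fin n) | ‖x‖ ∈ Ioo a b} :=
    measurable_norm measurableSet_Ioo
  rw [← lintegral_indicator hS,
    lintegral_eq_lintegral_sphere_lintegral_Ioi hn (hf.indicator hS)]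
  refine lintegral_congr fun ω => ?_
  have hsub : Ioo a b ⊆ Ioi 0 := fun r hr => ha.trans_lt hr.1
  have hres : (volume : Measure ℝ).restrict (Ioo a b) =
      (volume.restrict (Ioi 0)).restrict (Ioo a b) := by
    rw [Measure.restrict_restrict measurableSet_Ioo, inter_eq_self_of_subset_left hsub]
  rw [hres, ← lintegral_indicator measurableSet_Ioo]
  refine setLIntegral_congr_fun measurableSet_Ioi fun r hr => ?_
  have hr' : ‖r • (ω : EuclideanSpace ℝ (Fin n))‖ = r := by
    simp [norm_smul, abs_of_pos (mem_Ioi.1 hr)]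
  simp only [indicator, mem_ofPred_eq, hr', mul_ite, mul_zero]

theorem lintegral_surfaceMeasure {n : ℕ} {R : ℝ} {f : EuclideanSpace ℝ (Fin n) → ENNReal}
    (hf : Measurable f) :
    ∫⁻ x, f x ∂surfaceMeasure n R = ENNReal.ofReal (R ^ (n - 1)) *
      ∫⁻ ω : Metric.sphere (0 : EuclideanSpace ℝ (Fin n)) 1,
        f (R • (ω : EuclideanSpace ℝ (Fin n)))
          ∂(volume : Measure (EuclideanSpace ℝ (Fin n))).toSphere := by
  rw [surfaceMeasure, lintegral_smul_measure, lintegral_map hf (by fun_prop), smul_eq_mul]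

/-- A one-dimensional inequality with densities `r ^ (n - 1) P` and `r ^ (n - 1) V`, integrated over
the rays `r ↦ r ω`, gives an inequality on an annulus: the radial derivative is at most the gradient. -/
theorem annulus_lintegral_le {n : ℕ} (hn : 1 ≤ n) {a b κ : ℝ} (ha : 0 < a) (hab : a < b)
    (hκ : 0 ≤ κ) {V P : ℝ → ℝ} (hV : Measurable V) (hP : Measurable P)
    (hV0 : ∀ r ∈ Ioo a b, 0 ≤ V r)
    (hH : ∀ g : ℝ → ℝ, ContDiff ℝ 1 g →
      ∫⁻ r in Ioo a b, ENNReal.ofReal (r ^ (n - 1) * P r * g r ^ 2) ≤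
      (∫⁻ r in Ioo a b, ENNReal.ofReal (r ^ (n - 1) * V r * deriv g r ^ 2)) +
        ENNReal.ofReal (b ^ (n - 1) * κ * g b ^ 2))
    {w : EuclideanSpace ℝ (Fin n) → ℝ} (hw : ContDiff ℝ 1 w) :
    ∫⁻ x in {x | ‖x‖ ∈ Ioo a b}, ENNReal.ofReal (P ‖x‖ * w x ^ 2) ≤
    (∫⁻ x in {x | ‖x‖ ∈ Ioo a b}, ENNReal.ofReal (V ‖x‖ * ‖gradient w x‖ ^ 2)) +
      ENNReal.ofReal κ * ∫⁻ x, ENNReal.ofReal (w x ^ 2) ∂surfaceMeasure n b := by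
  have hb : 0 < b := ha.trans hab
  have hwc : Continuous w := hw.continuous
  have hgc : Continuous (gradient w) :=
    (LinearIsometryEquiv.continuous _).comp (hw.continuous_fderiv one_ne_zero)
  have hmw : Measurable fun x : EuclideanSpace ℝ (Fin n) => ENNReal.ofReal (w x ^ 2) :=
    (hwc.measurable.pow_const 2).ennreal_ofReal
  have hmω : Measurable fun ω : Metric.sphere (0 : EuclideanSpace ℝ (Fin n)) 1 =>
      ENNReal.ofReal (w (b • (ω : EuclideanSpace ℝ (Fin n))) ^ 2) := hmw.comp (by fun_prop)
  have hmP : Measurable fun x : EuclideanSpace ℝ (Fin n) => ENNReal.ofReal (P ‖x‖ * w x ^ 2) :=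
    ((hP.comp measurable_norm).mul (hwc.measurable.pow_const 2)).ennreal_ofReal
  have hmV : Measurable fun x : EuclideanSpace ℝ (Fin n) =>
      ENNReal.ofReal (V ‖x‖ * ‖gradient w x‖ ^ 2) :=
    ((hV.comp measurable_norm).mul (hgc.measurable.norm.pow_const 2)).ennreal_ofReal
  rw [setLIntegral_annulus hn ha.le hmP, setLIntegral_annulus hn ha.le hmV,
    lintegral_surfaceMeasure hmw, ← mul_assoc, ← lintegral_const_mul _ hmω,
    ← lintegral_add_right _ (hmω.const_mul _)]
  refine lintegral_mono fun ω => ?_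
  have hω : ‖(ω : EuclideanSpace ℝ (Fin n))‖ = 1 := by simp
  set e := (ω : EuclideanSpace ℝ (Fin n))
  have hg : ContDiff ℝ 1 fun r : ℝ => w (r • e) := hw.comp (by fun_prop)
  have hder : ∀ r : ℝ, deriv (fun r : ℝ => w (r • e)) r = fderiv ℝ w (r • e) e := fun r => by
    have h1 : HasDerivAt (fun r : ℝ => r • e) e r := by
      simpa using (hasDerivAt_id r).smul_const e
    exact ((hw.differentiable one_ne_zero _).hasFDerivAt.comp_hasDerivAt r h1).deriv
  have hnorm : ∀ r ∈ Ioo a b, ‖r • e‖ = r := fun r hr => by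
    rw [norm_smul, hω, mul_one, Real.norm_of_nonneg (ha.trans hr.1).le]
  have key := hH _ hg
  calc _ = ∫⁻ r in Ioo a b, ENNReal.ofReal (r ^ (n - 1) * P r * w (r • e) ^ 2) := by
        refine setLIntegral_congr_fun measurableSet_Ioo fun r hr => ?_
        simp only [hnorm r hr]
        rw [← ENNReal.ofReal_mul (pow_pos (ha.trans hr.1) _).le, mul_assoc]
    _ ≤ _ := key
    _ ≤ _ := by
        refine add_le_add (setLIntegral_mono' measurableSet_Ioo fun r hr => ?_) (le_of_eq ?_)
        · have hr0 := ha.trans hr.1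
          simp only [hnorm r hr]
          rw [← ENNReal.ofReal_mul (pow_pos hr0 _).le, ← mul_assoc]
          refine ENNReal.ofReal_le_ofReal (mul_le_mul_of_nonneg_left ?_
            (mul_nonneg (pow_pos hr0 _).le (hV0 r hr)))
          rw [hder, ← inner_gradient_left]
          refine sq_le_sq.2 ?_
          rw [abs_norm]
          exact (abs_real_inner_le_norm _ _).trans (by rw [hω, mul_one])
        · rw [ENNReal.ofReal_mul (mul_nonneg (pow_pos hb _).le hκ),
            ENNReal.ofReal_mul (pow_pos hb _).le, mul_comm (ENNReal.ofReal κ)]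

/-! ### Passage to the limit along smooth approximations -/

theorem lintegral_ofReal_norm_sq {α F : Type*} [MeasurableSpace α] [NormedAddCommGroup F]
    (μ : Measure α) (f : α → F) :
    ∫⁻ x, ENNReal.ofReal (‖f x‖ ^ 2) ∂μ = eLpNorm f 2 μ ^ 2 := by
  have := eLpNorm_nnreal_pow_eq_lintegral (f := f) (μ := μ) (p := 2) two_ne_zero
  norm_num at this
  rw [this]
  refine lintegral_congr fun x => ?_
  rw [ENNReal.ofReal_pow (norm_nonneg _), ofReal_norm]

theorem tendsto_lintegral_norm_sq {α F : Type*} [MeasurableSpace α] [NormedAddCommGroup F]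
    {μ : Measure α} {f : ℕ → α → F} (h : Tendsto (fun k => eLpNorm (f k) 2 μ) atTop (𝓝 0)) :
    Tendsto (fun k => ∫⁻ x, ENNReal.ofReal (‖f k x‖ ^ 2) ∂μ) atTop (𝓝 0) := by
  simp only [lintegral_ofReal_norm_sq]
  simpa using ENNReal.Tendsto.pow (n := 2) h

/-- Comparison of weighted square integrals of two functions, up to a factor `1 + ε` and an error
controlled by their `L²` distance. -/
theorem lintegral_weighted_norm_sq_le {α F : Type*} [MeasurableSpace α] [NormedAddCommGroup F]
    {μ : Measure α} {h : α → ℝ} {M ε : ℝ} (hε : 0 < ε) (hh : Measurable h)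
    (h0 : ∀ᵐ x ∂μ, 0 ≤ h x) (hM : ∀ᵐ x ∂μ, h x ≤ M)
    (w : α → F) {f : α → F} (hf : AEStronglyMeasurable f μ) :
    ∫⁻ x, ENNReal.ofReal (h x * ‖w x‖ ^ 2) ∂μ ≤
      ENNReal.ofReal (1 + ε) * ∫⁻ x, ENNReal.ofReal (h x * ‖f x‖ ^ 2) ∂μ +
      ENNReal.ofReal ((1 + ε⁻¹) * M) * ∫⁻ x, ENNReal.ofReal (‖w x - f x‖ ^ 2) ∂μ := by
  have hm : AEMeasurable (fun x => ENNReal.ofReal (h x * ‖f x‖ ^ 2)) μ :=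
    (hh.aemeasurable.mul (hf.norm.aemeasurable.pow_const 2)).ennreal_ofReal
  rw [← lintegral_const_mul'' _ hm, ← lintegral_const_mul' _ _ ENNReal.ofReal_ne_top,
    ← lintegral_add_left' (hm.const_mul _)]
  refine lintegral_mono_ae ?_
  filter_upwards [h0, hM] with x hx0 hxM
  have hM0 : 0 ≤ M := hx0.trans hxM
  rw [← ENNReal.ofReal_mul (by positivity), ← ENNReal.ofReal_mul (by positivity),
    ← ENNReal.ofReal_add (by positivity) (by positivity)]
  refine ENNReal.ofReal_le_ofReal ?_
  have htri : ‖w x‖ ≤ ‖f x‖ + ‖w x - f x‖ := by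
    simpa using norm_add_le (f x) (w x - f x)
  -- Young's inequality `2 s t ≤ ε s² + ε⁻¹ t²`.
  have hyoung : ‖w x‖ ^ 2 ≤ (1 + ε) * ‖f x‖ ^ 2 + (1 + ε⁻¹) * ‖w x - f x‖ ^ 2 := by
    have h1 : ‖w x‖ ^ 2 ≤ (‖f x‖ + ‖w x - f x‖) ^ 2 :=
      pow_le_pow_left₀ (norm_nonneg _) htri 2
    have h2 : 0 ≤ ε⁻¹ * (ε * ‖f x‖ - ‖w x - f x‖) ^ 2 := by positivity
    have h3 : ε⁻¹ * (ε * ‖f x‖ - ‖w x - f x‖) ^ 2 = ε * ‖f x‖ ^ 2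
        - 2 * ‖f x‖ * ‖w x - f x‖ + ε⁻¹ * ‖w x - f x‖ ^ 2 := by
      field_simp
      ring
    nlinarith
  calc h x * ‖w x‖ ^ 2
      ≤ h x * ((1 + ε) * ‖f x‖ ^ 2 + (1 + ε⁻¹) * ‖w x - f x‖ ^ 2) := by gcongr
    _ = (1 + ε) * (h x * ‖f x‖ ^ 2) + (1 + ε⁻¹) * h x * ‖w x - f x‖ ^ 2 := by ring
    _ ≤ _ := by gcongr

theorem exists_subseq_tendsto_ae_of_eLpNorm {α : Type*} [MeasurableSpace α] {μ : Measure α}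
    {w : ℕ → α → ℝ} {u : α → ℝ} (hw : ∀ k, AEStronglyMeasurable (w k) μ)
    (hu : AEStronglyMeasurable u μ)
    (h : Tendsto (fun k => eLpNorm (fun x => w k x - u x) 2 μ) atTop (𝓝 0)) :
    ∃ ns : ℕ → ℕ, StrictMono ns ∧ ∀ᵐ x ∂μ, Tendsto (fun k => w (ns k) x) atTop (𝓝 (u x)) :=
  (tendstoInMeasure_of_tendsto_eLpNorm two_ne_zero hw hu h).exists_seq_tendsto_ae

/-- On an annulus away from the origin, the inequality passes from smooth functions to their limit in
the sense of `IsTrace`. There `V` is bounded, so the energies converge; `P` may be unbounded near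
`∂B`, and Fatou's lemma is used for the left-hand side. -/
theorem lintegral_le_of_isTrace_annulus {n : ℕ} (hn : 1 ≤ n) {a R κ : ℝ} (ha : 0 < a)
    (haR : a < R) (hκ : 0 ≤ κ) {V P : ℝ → ℝ} (hV : Measurable V) (hP : Measurable P) {M : ℝ}
    (hV0 : ∀ r ∈ Ioo a R, 0 ≤ V r) (hVM : ∀ r ∈ Ioo a R, V r ≤ M)
    (hH : ∀ g : ℝ → ℝ, ContDiff ℝ 1 g →
      ∫⁻ r in Ioo a R, ENNReal.ofReal (r ^ (n - 1) * P r * g r ^ 2) ≤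
      (∫⁻ r in Ioo a R, ENNReal.ofReal (r ^ (n - 1) * V r * deriv g r ^ 2)) +
        ENNReal.ofReal (R ^ (n - 1) * κ * g R ^ 2))
    {u T : EuclideanSpace ℝ (Fin n) → ℝ}
    {G : EuclideanSpace ℝ (Fin n) → EuclideanSpace ℝ (Fin n)}
    (hu : AEStronglyMeasurable u (volume.restrict (Metric.ball 0 R)))
    (hG : AEStronglyMeasurable G (volume.restrict (Metric.ball 0 R)))
    (hT : IsTrace R u G T) :
    ∫⁻ x in {x | ‖x‖ ∈ Ioo a R}, ENNReal.ofReal (P ‖x‖ * u x ^ 2) ≤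
    (∫⁻ x in {x | ‖x‖ ∈ Ioo a R}, ENNReal.ofReal (V ‖x‖ * ‖G x‖ ^ 2)) +
      ENNReal.ofReal κ * ∫⁻ x, ENNReal.ofReal (T x ^ 2) ∂surfaceMeasure n R := by
  obtain ⟨hTL, w, hw, hwu, hwG, hwT⟩ := hT
  have hSm : MeasurableSet {x : EuclideanSpace ℝ (Fin n) | ‖x‖ ∈ Ioo a R} :=
    measurable_norm measurableSet_Ioo
  set S := {x : EuclideanSpace ℝ (Fin n) | ‖x‖ ∈ Ioo a R} with hS
  have hSB : S ⊆ Metric.ball 0 R := fun x hx => by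
    rw [mem_ball_zero_iff]; exact hx.2
  have hμ : volume.restrict S ≤ volume.restrict (Metric.ball (0 : EuclideanSpace ℝ (Fin n)) R) :=
    Measure.restrict_mono hSB le_rfl
  have hmem : ∀ᵐ x ∂volume.restrict S, ‖x‖ ∈ Ioo a R := ae_restrict_mem hSm
  have hwu' : Tendsto (fun k => eLpNorm (fun x => w k x - u x) 2 (volume.restrict S)) atTop
      (𝓝 0) := tendsto_of_tendsto_of_tendsto_of_le_of_le tendsto_const_nhds hwu
        (fun _ => zero_le) (fun k => eLpNorm_mono_measure _ hμ)
  have hwG' : Tendsto (fun k => eLpNorm (fun x => gradient (w k) x - G x) 2 (volume.restrict S))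
      atTop (𝓝 0) := tendsto_of_tendsto_of_tendsto_of_le_of_le tendsto_const_nhds hwG
        (fun _ => zero_le) (fun k => eLpNorm_mono_measure _ hμ)
  have hw1 : ∀ k, ContDiff ℝ 1 (w k) := fun k => (hw k).of_le (by exact_mod_cast le_top)
  obtain ⟨ns, hns, hae⟩ := exists_subseq_tendsto_ae_of_eLpNorm
    (fun k => (hw k).continuous.aestronglyMeasurable) (hu.mono_measure hμ) hwu'
  set E := ∫⁻ x in S, ENNReal.ofReal (V ‖x‖ * ‖G x‖ ^ 2) with hE
  set τ := ∫⁻ x, ENNReal.ofReal (T x ^ 2) ∂surfaceMeasure n R with hτ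
  have hfatou : ∫⁻ x in S, ENNReal.ofReal (P ‖x‖ * u x ^ 2) ≤
      liminf (fun k => ∫⁻ x in S, ENNReal.ofReal (P ‖x‖ * w (ns k) x ^ 2)) atTop := by
    refine le_trans (lintegral_mono_ae ?_) (lintegral_liminf_le fun k => ?_)
    · filter_upwards [hae] with x hx
      exact ((ENNReal.continuous_ofReal.tendsto _).comp
        (tendsto_const_nhds.mul (hx.pow 2))).liminf_eq.ge
    · exact ((hP.comp measurable_norm).mul
        ((hw (ns k)).continuous.measurable.pow_const 2)).ennreal_ofReal
  have hbound : ∀ ε : ℝ, 0 < ε → ∫⁻ x in S, ENNReal.ofReal (P ‖x‖ * u x ^ 2) ≤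
      ENNReal.ofReal (1 + ε) * (E + ENNReal.ofReal κ * τ) := by
    intro ε hε
    have hk : ∀ k, ∫⁻ x in S, ENNReal.ofReal (P ‖x‖ * w k x ^ 2) ≤
        (ENNReal.ofReal (1 + ε) * E + ENNReal.ofReal ((1 + ε⁻¹) * M) *
          ∫⁻ x in S, ENNReal.ofReal (‖gradient (w k) x - G x‖ ^ 2)) +
        ENNReal.ofReal κ * (ENNReal.ofReal (1 + ε) * τ + ENNReal.ofReal ((1 + ε⁻¹) * 1) *
          ∫⁻ x, ENNReal.ofReal (‖w k x - T x‖ ^ 2) ∂surfaceMeasure n R) := by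
      intro k
      refine (annulus_lintegral_le hn ha haR hκ hV hP hV0 hH (hw1 k)).trans ?_
      refine add_le_add ?_ (mul_le_mul_right ?_ _)
      · exact lintegral_weighted_norm_sq_le hε (hV.comp measurable_norm)
          (hmem.mono fun x hx => hV0 _ hx) (hmem.mono fun x hx => hVM _ hx) _
          (hG.mono_measure hμ)
      · have := lintegral_weighted_norm_sq_le (μ := surfaceMeasure n R) (h := fun _ => 1) hε
          measurable_const (Eventually.of_forall fun _ => zero_le_one)
          (Eventually.of_forall fun _ => le_rfl) (w k) hTL.1
        simpa only [one_mul, Real.norm_eq_abs, sq_abs] using this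
    have hlim : Tendsto (fun k => (ENNReal.ofReal (1 + ε) * E + ENNReal.ofReal ((1 + ε⁻¹) * M) *
          ∫⁻ x in S, ENNReal.ofReal (‖gradient (w k) x - G x‖ ^ 2)) +
        ENNReal.ofReal κ * (ENNReal.ofReal (1 + ε) * τ + ENNReal.ofReal ((1 + ε⁻¹) * 1) *
          ∫⁻ x, ENNReal.ofReal (‖w k x - T x‖ ^ 2) ∂surfaceMeasure n R)) atTop
        (𝓝 ((ENNReal.ofReal (1 + ε) * E + ENNReal.ofReal ((1 + ε⁻¹) * M) * 0) +
        ENNReal.ofReal κ * (ENNReal.ofReal (1 + ε) * τ + ENNReal.ofReal ((1 + ε⁻¹) * 1) * 0))) := by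
      refine Tendsto.add (tendsto_const_nhds.add ?_)
        (ENNReal.Tendsto.const_mul (tendsto_const_nhds.add ?_) (Or.inr ENNReal.ofReal_ne_top))
      · exact ENNReal.Tendsto.const_mul (tendsto_lintegral_norm_sq hwG')
          (Or.inr ENNReal.ofReal_ne_top)
      · exact ENNReal.Tendsto.const_mul (tendsto_lintegral_norm_sq hwT)
          (Or.inr ENNReal.ofReal_ne_top)
    refine hfatou.trans ((liminf_le_liminf (Eventually.of_forall fun k => hk (ns k))).trans
      ((hlim.comp hns.tendsto_atTop).liminf_eq.le.trans (le_of_eq ?_)))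
    ring
  have hlim : Tendsto (fun ε : ℝ => ENNReal.ofReal (1 + ε) * (E + ENNReal.ofReal κ * τ)) (𝓝[>] 0)
      (𝓝 (1 * (E + ENNReal.ofReal κ * τ))) := by
    refine ENNReal.Tendsto.mul_const ?_ (Or.inl one_ne_zero)
    have : Tendsto (fun ε : ℝ => ENNReal.ofReal (1 + ε)) (𝓝 0) (𝓝 (ENNReal.ofReal (1 + 0))) :=
      (ENNReal.continuous_ofReal.comp (continuous_const.add continuous_id)).tendsto 0
    simpa using this.mono_left nhdsWithin_le_nhds
  rw [one_mul] at hlim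
  exact ge_of_tendsto hlim (eventually_mem_nhdsWithin.mono fun ε hε => hbound ε hε)

/-- The inequality on the whole ball: the inner radius of the annulus tends to `0`. -/
theorem lintegral_le_of_isTrace {n : ℕ} (hn : 1 ≤ n) {R κ : ℝ} (hR : 0 < R)
    (hκ : 0 ≤ κ) {V P : ℝ → ℝ} (hV : Measurable V) (hP : Measurable P)
    (hV0 : ∀ r ∈ Ioo 0 R, 0 ≤ V r) (hVM : ∀ a, 0 < a → ∃ M, ∀ r ∈ Ioo a R, V r ≤ M)
    (hH : ∀ᶠ a in 𝓝[>] (0 : ℝ), ∀ g : ℝ → ℝ, ContDiff ℝ 1 g →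
      ∫⁻ r in Ioo a R, ENNReal.ofReal (r ^ (n - 1) * P r * g r ^ 2) ≤
      (∫⁻ r in Ioo a R, ENNReal.ofReal (r ^ (n - 1) * V r * deriv g r ^ 2)) +
        ENNReal.ofReal (R ^ (n - 1) * κ * g R ^ 2))
    {u T : EuclideanSpace ℝ (Fin n) → ℝ}
    {G : EuclideanSpace ℝ (Fin n) → EuclideanSpace ℝ (Fin n)}
    (hu : AEStronglyMeasurable u (volume.restrict (Metric.ball 0 R)))
    (hG : AEStronglyMeasurable G (volume.restrict (Metric.ball 0 R)))
    (hT : IsTrace R u G T) :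
    ∫⁻ x in Metric.ball 0 R, ENNReal.ofReal (P ‖x‖ * u x ^ 2) ≤
    (∫⁻ x in Metric.ball 0 R, ENNReal.ofReal (V ‖x‖ * ‖G x‖ ^ 2)) +
      ENNReal.ofReal κ * ∫⁻ x, ENNReal.ofReal (T x ^ 2) ∂surfaceMeasure n R := by
  have : Nonempty (Fin n) := ⟨⟨0, hn⟩⟩
  have hmem : ∀ᶠ a in 𝓝[>] (0 : ℝ), a ∈ Ioo 0 R := Ioo_mem_nhdsGT hR
  have hSm : ∀ a, MeasurableSet {x : EuclideanSpace ℝ (Fin n) | ‖x‖ ∈ Ioo a R} := fun a =>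
    measurable_norm measurableSet_Ioo
  have hSB : ∀ a, {x : EuclideanSpace ℝ (Fin n) | ‖x‖ ∈ Ioo a R} ⊆ Metric.ball 0 R :=
    fun a x hx => by rw [mem_ball_zero_iff]; exact hx.2
  have hcover : AECover (volume.restrict (Metric.ball (0 : EuclideanSpace ℝ (Fin n)) R))
      (𝓝[>] (0 : ℝ)) (fun a => {x | ‖x‖ ∈ Ioo a R}) := by
    refine ⟨?_, hSm⟩
    filter_upwards [ae_restrict_mem measurableSet_ball,
      ae_restrict_of_ae (Measure.ae_ne volume (0 : EuclideanSpace ℝ (Fin n)))] with x hx hx0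
    filter_upwards [Ioo_mem_nhdsGT (norm_pos_iff.2 hx0)] with a ha
    exact ⟨ha.2, mem_ball_zero_iff.1 hx⟩
  have hlim := hcover.lintegral_tendsto_of_countably_generated
    (f := fun x => ENNReal.ofReal (P ‖x‖ * u x ^ 2))
    ((hP.comp measurable_norm).aemeasurable.mul (hu.aemeasurable.pow_const 2)).ennreal_ofReal
  refine le_of_tendsto hlim ?_
  filter_upwards [hmem, hH] with a ha hHa
  obtain ⟨M, hM⟩ := hVM a ha.1
  rw [Measure.restrict_restrict (hSm a), inter_eq_self_of_subset_left (hSB a)]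
  refine (lintegral_le_of_isTrace_annulus hn ha.1 ha.2 hκ hV hP
    (fun r hr => hV0 r ⟨ha.1.trans hr.1, hr.2⟩) hM hHa hu hG hT).trans ?_
  gcongr
  exact hSB a

/-! ### One-dimensional inequalities up to the outer radius, and the ball -/

/-- The density `V (α² / r² + Q)` of the left-hand side of the Hardy inequality. -/
noncomputable def hardyDensity (α : ℝ) (V Q : ℝ → ℝ) (r : ℝ) : ℝ :=
  V r * (α ^ 2 / r ^ 2 + Q r)

/-- The conditions on the weight `V` on `(0, R]`: it is positive and continuous, `C¹` on `(0, R)`, and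
`r V' / V + λ ≥ 0` there, that is, `r ^ λ V` is nondecreasing. -/
structure IsHardyWeight (R lam : ℝ) (V : ℝ → ℝ) : Prop where
  pos : ∀ r ∈ Ioc 0 R, 0 < V r
  continuousOn : ContinuousOn V (Ioc 0 R)
  contDiffOn : ContDiffOn ℝ 1 V (Ioo 0 R)
  nonneg : ∀ r ∈ Ioo 0 R, 0 ≤ r * deriv V r / V r + lam

theorem IsHardyWeight.differentiableAt {R lam : ℝ} {V : ℝ → ℝ} (hV : IsHardyWeight R lam V) {r : ℝ}
    (hr : r ∈ Ioo 0 R) : DifferentiableAt ℝ V r :=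
  (hV.contDiffOn.differentiableOn one_ne_zero).differentiableAt (isOpen_Ioo.mem_nhds hr)

theorem IsPosBesselSolutionUpTo.lintegral_le {n : ℕ} (hn : 1 ≤ n) {R lam α c : ℝ} (hα : 0 ≤ α)
    (hlam : 2 * α = (n : ℝ) - 2 - lam) {V W φ : ℝ → ℝ} (hV : IsHardyWeight R lam V)
    (hW : ContinuousOn W (Ioo 0 R)) (hW0 : ∀ r ∈ Ioo 0 R, 0 ≤ W r) (hc : 0 ≤ c)
    (h : IsPosBesselSolutionUpTo R c W φ) {a : ℝ} (ha : a ∈ Ioo 0 R) {g : ℝ → ℝ}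
    (hg : ContDiff ℝ 1 g) :
    ∫⁻ r in Ioo a R, ENNReal.ofReal (r ^ (n - 1) *
        hardyDensity α V (fun r => c * W r) r * g r ^ 2) ≤
      (∫⁻ r in Ioo a R, ENNReal.ofReal (r ^ (n - 1) * V r * deriv g r ^ 2)) +
        ENNReal.ofReal (R ^ (n - 1) * (V R * (α / R - derivWithin φ (Ioc 0 R) R / φ R))
          * g R ^ 2) := by
  have hφ := h.toIsPosBesselSolution
  have hI : Icc a R ⊆ Ioc 0 R := fun r hr => ⟨ha.1.trans_le hr.1, hr.2⟩
  have hIo : Ioo a R ⊆ Ioo 0 R := Ioo_subset_Ioo_left ha.1.le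
  have hIco : Ico a R ⊆ Ioo 0 R := fun r hr => ⟨ha.1.trans_le hr.1, hr.2⟩
  have hd : ∀ r ∈ Ioo 0 R, derivWithin φ (Ioc 0 R) r = deriv φ r := fun r hr =>
    derivWithin_of_mem_nhds (Ioc_mem_nhds hr.1 hr.2)
  have key := bessel_lintegral_le hn hα hlam ha.1 ha.2 (V := V) (ψ := φ)
    (dψ := derivWithin φ (Ioc 0 R)) (Q := fun r => c * W r) (hV.continuousOn.mono hI)
    (fun r hr => hV.pos r (hI hr)) (fun r hr => hV.differentiableAt (hIo hr))
    (fun r hr => hV.nonneg r (hIo hr)) (h.contDiffOn_Ioc.continuousOn.mono hI)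
    ((h.contDiffOn_Ioc.continuousOn_derivWithin (uniqueDiffOn_Ioc 0 R) le_rfl).mono hI)
    (fun r hr => ?_) (fun r hr => ?_) (fun r hr => ?_) (fun r hr => ?_)
    (continuousOn_const.mul (hW.mono hIco)) (fun r hr => mul_nonneg hc (hW0 r (hIo hr))) hg
  · refine le_add_self.trans (key.trans (le_of_eq ?_))
    rw [besselFlux, mul_assoc (R ^ (n - 1))]
  · rcases (hI hr).2.lt_or_eq with hlt | rfl
    · exact hφ.pos r ⟨(hI hr).1, hlt⟩
    · exact h.pos_right
  · rw [hd r (hIco hr)]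
    exact hφ.deriv_nonpos hc hW0 (hIco hr)
  · rw [hd r (hIo hr)]
    exact hφ.hasDerivAt (hIo hr)
  · rw [hd r (hIo hr)]
    refine (hφ.hasDerivAt_deriv (hIo hr)).congr_of_eventuallyEq ?_
    filter_upwards [isOpen_Ioo.mem_nhds (hIo hr)] with s hs using hd s hs

theorem IsPosBesselSolutionUpTo.derivWithin_nonpos {R c : ℝ} (hR : 0 < R) {W φ : ℝ → ℝ}
    (hc : 0 ≤ c) (hW0 : ∀ r ∈ Ioo 0 R, 0 ≤ W r) (h : IsPosBesselSolutionUpTo R c W φ) :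
    derivWithin φ (Ioc 0 R) R ≤ 0 := by
  have hcont := (h.contDiffOn_Ioc.continuousOn_derivWithin (uniqueDiffOn_Ioc 0 R) le_rfl) R
    ⟨hR, le_rfl⟩
  have hlim : Tendsto (derivWithin φ (Ioc 0 R)) (𝓝[<] R) (𝓝 (derivWithin φ (Ioc 0 R) R)) :=
    hcont.mono_of_mem_nhdsWithin (mem_of_superset (Ioo_mem_nhdsLT hR) Ioo_subset_Ioc_self)
  refine le_of_tendsto hlim ?_
  filter_upwards [Ioo_mem_nhdsLT hR] with r hr
  rw [derivWithin_of_mem_nhds (Ioc_mem_nhds hr.1 hr.2)]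
  exact h.toIsPosBesselSolution.deriv_nonpos hc hW0 hr

theorem setLIntegral_Ioo_add_adjacent {a ρ b : ℝ} (h1 : a < ρ) (h2 : ρ < b) (f : ℝ → ENNReal) :
    ∫⁻ r in Ioo a b, f r = (∫⁻ r in Ioo a ρ, f r) + ∫⁻ r in Ioo ρ b, f r := by
  have hdisj : Disjoint (Ioc a ρ) (Ioo ρ b) :=
    disjoint_left.2 fun r hr hr' => hr'.1.not_ge hr.2
  rw [← Ioc_union_Ioo_eq_Ioo h1.le h2, lintegral_union measurableSet_Ioo hdisj,
    Measure.restrict_congr_set (Ioo_ae_eq_Ioc (a := a) (b := ρ))]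

/-- A one-dimensional inequality that needs no control of `φ` at `R`. The potential `c W` is cut off
at `ρ` and multiplied by `φ / (φ + ε)`. Then `φ + ε` is a solution on `(0, ρ)`, and on `[ρ, R]` it is
continued by its tangent in the variable `log r`, a solution for the potential `0`. The tangent is at
least `φ + ε`, so it is still positive at `R` and the boundary term there has a finite coefficient
`κ`, whose value does not matter for functions with zero trace. -/
theorem IsPosBesselSolution.exists_truncated_lintegral_le {n : ℕ} (hn : 1 ≤ n) {R lam α c : ℝ}
    (hα : 0 ≤ α) (hlam : 2 * α = (n : ℝ) - 2 - lam) {V W φ : ℝ → ℝ} (hV : IsHardyWeight R lam V)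
    (hW : ContinuousOn W (Ioo 0 R)) (hW0 : ∀ r ∈ Ioo 0 R, 0 ≤ W r) (hc : 0 ≤ c)
    (h : IsPosBesselSolution R c W φ) {ρ ε : ℝ} (hρ : ρ ∈ Ioo 0 R) (hε : 0 < ε) :
    ∃ κ : ℝ, 0 ≤ κ ∧ ∀ a ∈ Ioo 0 ρ, ∀ g : ℝ → ℝ, ContDiff ℝ 1 g →
      ∫⁻ r in Ioo a R, ENNReal.ofReal (r ^ (n - 1) * hardyDensity α V
        ((Iio ρ).indicator fun r => c * W r * (φ r / (φ r + ε))) r * g r ^ 2) ≤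
      (∫⁻ r in Ioo a R, ENNReal.ofReal (r ^ (n - 1) * V r * deriv g r ^ 2)) +
        ENNReal.ofReal (R ^ (n - 1) * κ * g R ^ 2) := by
  set m := ρ * deriv φ ρ with hm
  have hR : 0 < R := hρ.1.trans hρ.2
  have hm0 : m ≤ 0 := mul_nonpos_of_nonneg_of_nonpos hρ.1.le (h.deriv_nonpos hc hW0 hρ)
  set ψ : ℝ → ℝ := fun r => φ ρ + ε + m * Real.log (r / ρ) with hψ
  have hIR : Icc ρ R ⊆ Ioc 0 R := fun r hr => ⟨hρ.1.trans_le hr.1, hr.2⟩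
  have hIoR : Ioo ρ R ⊆ Ioo 0 R := Ioo_subset_Ioo_left hρ.1.le
  have hψ' : ∀ r, 0 < r → HasDerivAt ψ (m / r) r := fun r hr => by
    have hlog : HasDerivAt (fun r => Real.log (r / ρ)) (1 / ρ / (r / ρ)) r :=
      ((hasDerivAt_id r).div_const ρ).log (div_pos hr hρ.1).ne'
    refine ((hlog.const_mul m).const_add (φ ρ + ε)).congr_deriv ?_
    have := hρ.1.ne'
    field_simp
  have hψlt : ∀ r ∈ Ioo 0 R, ε ≤ ψ r := fun r hr => by
    have h1 := h.le_tangent hc hW0 hρ hr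
    have h2 := h.pos r hr
    simp only [hψ, hm]
    linarith
  have hψpos : ∀ r ∈ Icc ρ R, 0 < ψ r := fun r hr => by
    rcases hr.2.lt_or_eq with hlt | rfl
    · exact hε.trans_le (hψlt r ⟨(hIR hr).1, hlt⟩)
    · refine hε.trans_le (ge_of_tendsto (((hψ' r hR).continuousAt).mono_left
        (nhdsWithin_le_nhds (s := Iio r))) ?_)
      filter_upwards [Ioo_mem_nhdsLT hR] with s hs using hψlt s hs
  have hRmem : R ∈ Icc ρ R := ⟨hρ.2.le, le_rfl⟩
  refine ⟨V R * (α / R - m / R / ψ R), ?_, fun a ha g hg => ?_⟩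
  · refine mul_nonneg (hV.pos R ⟨hR, le_rfl⟩).le (sub_nonneg.2 ?_)
    exact (div_nonpos_of_nonpos_of_nonneg (div_nonpos_of_nonpos_of_nonneg hm0 hR.le)
      (hψpos R hRmem).le).trans (div_nonneg hα hR.le)
  have hIa : Icc a ρ ⊆ Ioo 0 R := fun r hr => ⟨ha.1.trans_le hr.1, hr.2.trans_lt hρ.2⟩
  have hIoa : Ioo a ρ ⊆ Ioo 0 R := Ioo_subset_Icc_self.trans hIa
  have hφε : ∀ r ∈ Ioo 0 R, 0 < φ r + ε := fun r hr => add_pos (h.pos r hr) hε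
  have hφc : ContinuousOn φ (Icc a ρ) := h.contDiffOn.continuousOn.mono hIa
  have key1 := bessel_lintegral_le hn hα hlam ha.1 ha.2 (V := V) (ψ := fun r => φ r + ε)
    (dψ := deriv φ) (Q := fun r => c * W r * (φ r / (φ r + ε)))
    (hV.continuousOn.mono (hIa.trans Ioo_subset_Ioc_self))
    (fun r hr => hV.pos r (Ioo_subset_Ioc_self (hIa hr)))
    (fun r hr => hV.differentiableAt (hIoa hr)) (fun r hr => hV.nonneg r (hIoa hr))
    (hφc.add continuousOn_const) (h.contDiffOn_deriv.continuousOn.mono hIa)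
    (fun r hr => hφε r (hIa hr))
    (fun r hr => h.deriv_nonpos hc hW0 (hIa (Ico_subset_Icc_self hr)))
    (fun r hr => (h.hasDerivAt (hIoa hr)).add_const ε)
    (fun r hr => (h.hasDerivAt_deriv (hIoa hr)).congr_deriv (by
      have := (hφε r (hIoa hr)).ne'
      field_simp))
    ((((continuousOn_const.mul (hW.mono hIa)).mul (hφc.div (hφc.add continuousOn_const)
      fun r hr => (hφε r (hIa hr)).ne'))).mono Ico_subset_Icc_self)
    (fun r hr => mul_nonneg (mul_nonneg hc (hW0 r (hIoa hr)))
      (div_nonneg (h.pos r (hIoa hr)).le (hφε r (hIoa hr)).le)) hg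
  have key2 := bessel_lintegral_le hn hα hlam hρ.1 hρ.2 (V := V) (ψ := ψ)
    (dψ := fun r => m / r) (Q := fun _ => 0) (hV.continuousOn.mono hIR)
    (fun r hr => hV.pos r (hIR hr))
    (fun r hr => hV.differentiableAt (hIoR hr)) (fun r hr => hV.nonneg r (hIoR hr))
    (fun r hr => (hψ' r (hIR hr).1).continuousAt.continuousWithinAt)
    (continuousOn_const.div continuousOn_id fun r hr => (hIR hr).1.ne') hψpos
    (fun r hr => div_nonpos_of_nonpos_of_nonneg hm0 (hIR (Ico_subset_Icc_self hr)).1.le)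
    (fun r hr => hψ' r (hIoR hr).1)
    (fun r hr => by
      have hr0 := (hIoR hr).1.ne'
      have h1 := ((hasDerivAt_id r).inv hr0).const_mul m
      refine (h1.congr_of_eventuallyEq (Eventually.of_forall fun s => ?_)).congr_deriv ?_
      · exact div_eq_mul_inv m s
      · simp only [id]
        field_simp
        ring)
    continuousOn_const (fun _ _ => le_rfl) hg
  -- At `ρ` the two solutions have the same value and the same derivative.
  have hmatch : besselFlux n α V (fun r => φ r + ε) (deriv φ) ρ
      = besselFlux n α V ψ (fun r => m / r) ρ := by
    have hρ0 := hρ.1.ne'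
    simp only [besselFlux, hψ, hm, div_self hρ0, Real.log_one, mul_zero, add_zero,
      mul_div_cancel_left₀ _ hρ0]
  rw [hmatch] at key1
  rw [setLIntegral_Ioo_add_adjacent ha.2 hρ.2, setLIntegral_Ioo_add_adjacent ha.2 hρ.2]
  have e1 : ∫⁻ r in Ioo a ρ, ENNReal.ofReal (r ^ (n - 1) * hardyDensity α V
        ((Iio ρ).indicator fun r => c * W r * (φ r / (φ r + ε))) r * g r ^ 2) =
      ∫⁻ r in Ioo a ρ, ENNReal.ofReal (r ^ (n - 1) *
        (V r * (α ^ 2 / r ^ 2 + c * W r * (φ r / (φ r + ε)))) * g r ^ 2) :=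
    setLIntegral_congr_fun measurableSet_Ioo fun r hr => by
      simp only [hardyDensity, indicator_of_mem (mem_Iio.2 hr.2)]
  have e2 : ∫⁻ r in Ioo ρ R, ENNReal.ofReal (r ^ (n - 1) * hardyDensity α V
        ((Iio ρ).indicator fun r => c * W r * (φ r / (φ r + ε))) r * g r ^ 2) =
      ∫⁻ r in Ioo ρ R, ENNReal.ofReal (r ^ (n - 1) *
        (V r * (α ^ 2 / r ^ 2 + 0)) * g r ^ 2) :=
    setLIntegral_congr_fun measurableSet_Ioo fun r hr => by
      simp only [hardyDensity, indicator_of_notMem (notMem_Iio.2 hr.1.le)]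
  rw [e1, e2]
  have e3 : besselFlux n α V ψ (fun r => m / r) R
      = R ^ (n - 1) * (V R * (α / R - m / R / ψ R)) := by
    rw [besselFlux, mul_assoc]
  rw [e3] at key2
  calc _ ≤ _ := add_le_add_left (le_add_self.trans key1) _
    _ ≤ _ := by
      rw [add_assoc, add_assoc]
      exact add_le_add_right key2 _

theorem measurable_indicator_of_continuousOn {s : Set ℝ} (hs : MeasurableSet s) {f : ℝ → ℝ}
    (hf : ContinuousOn f s) : Measurable (s.indicator f) := by
  classical
  rw [← piecewise_eq_indicator]
  exact hf.measurable_piecewise continuousOn_const hs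

theorem ae_norm_mem_Ioo_of_ball {n : ℕ} (hn : 1 ≤ n) (R : ℝ) :
    ∀ᵐ x ∂volume.restrict (Metric.ball (0 : EuclideanSpace ℝ (Fin n)) R), ‖x‖ ∈ Ioo 0 R := by
  have : Nonempty (Fin n) := ⟨⟨0, hn⟩⟩
  filter_upwards [ae_restrict_mem measurableSet_ball,
    ae_restrict_of_ae (Measure.ae_ne volume (0 : EuclideanSpace ℝ (Fin n)))] with x hx hx0
  exact ⟨norm_pos_iff.2 hx0, mem_ball_zero_iff.1 hx⟩

/-- `lintegral_le_of_isTrace` for functions that are regular on `(0, R)` only; outside that interval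
they are replaced by `0`. -/
theorem lintegral_ball_le {n : ℕ} (hn : 1 ≤ n) {R lam α κ : ℝ} (hR : 0 < R) (hκ : 0 ≤ κ)
    {V Q : ℝ → ℝ} (hV : IsHardyWeight R lam V) (hQ : Measurable ((Ioo 0 R).indicator Q))
    (hH : ∀ᶠ a in 𝓝[>] (0 : ℝ), ∀ g : ℝ → ℝ, ContDiff ℝ 1 g →
      ∫⁻ r in Ioo a R, ENNReal.ofReal (r ^ (n - 1) * hardyDensity α V Q r * g r ^ 2) ≤
      (∫⁻ r in Ioo a R, ENNReal.ofReal (r ^ (n - 1) * V r * deriv g r ^ 2)) +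
        ENNReal.ofReal (R ^ (n - 1) * κ * g R ^ 2))
    {u T : EuclideanSpace ℝ (Fin n) → ℝ}
    {G : EuclideanSpace ℝ (Fin n) → EuclideanSpace ℝ (Fin n)}
    (hu : AEStronglyMeasurable u (volume.restrict (Metric.ball 0 R)))
    (hG : AEStronglyMeasurable G (volume.restrict (Metric.ball 0 R)))
    (hT : IsTrace R u G T) :
    ∫⁻ x in Metric.ball 0 R, ENNReal.ofReal (hardyDensity α V Q ‖x‖ * u x ^ 2) ≤
    (∫⁻ x in Metric.ball 0 R, ENNReal.ofReal (V ‖x‖ * ‖G x‖ ^ 2)) +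
      ENNReal.ofReal κ * ∫⁻ x, ENNReal.ofReal (T x ^ 2) ∂surfaceMeasure n R := by
  have hVm : Measurable ((Ioo 0 R).indicator V) :=
    measurable_indicator_of_continuousOn measurableSet_Ioo
      (hV.continuousOn.mono Ioo_subset_Ioc_self)
  have hball := ae_norm_mem_Ioo_of_ball hn R
  have hDind : ∀ r ∈ Ioo 0 R, hardyDensity α ((Ioo 0 R).indicator V) ((Ioo 0 R).indicator Q) r
      = hardyDensity α V Q r := fun r hr => by
    simp only [hardyDensity, indicator_of_mem hr]
  have key := lintegral_le_of_isTrace hn hR hκ hVm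
    (P := hardyDensity α ((Ioo 0 R).indicator V) ((Ioo 0 R).indicator Q))
    (hVm.mul ((measurable_const.div (measurable_id.pow_const 2)).add hQ))
    (fun r hr => by rw [indicator_of_mem hr]; exact (hV.pos r (Ioo_subset_Ioc_self hr)).le)
    (fun a ha => by
      have hsub : Icc a R ⊆ Ioc 0 R := fun r hr => ⟨ha.trans_le hr.1, hr.2⟩
      obtain ⟨M, hM⟩ := isCompact_Icc.bddAbove_image (hV.continuousOn.mono hsub)
      refine ⟨M, fun r hr => ?_⟩
      rw [indicator_of_mem (Ioo_subset_Ioo_left ha.le hr)]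
      exact hM (mem_image_of_mem V (Ioo_subset_Icc_self hr)))
    (by
      filter_upwards [hH, eventually_mem_nhdsWithin] with a hHa (ha : 0 < a) g hg
      have hsub : Ioo a R ⊆ Ioo 0 R := Ioo_subset_Ioo_left ha.le
      refine (le_of_eq ?_).trans ((hHa g hg).trans (add_le_add_left (le_of_eq ?_) _))
      · exact setLIntegral_congr_fun measurableSet_Ioo fun r hr => by
          simp only [hDind r (hsub hr)]
      · exact setLIntegral_congr_fun measurableSet_Ioo fun r hr => by
          simp only [indicator_of_mem (hsub hr)])
    hu hG hT
  refine (le_of_eq ?_).trans (key.trans (add_le_add_left (le_of_eq ?_) _))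
  · refine lintegral_congr_ae ?_
    filter_upwards [hball] with x hx
    rw [hDind _ hx]
  · refine lintegral_congr_ae ?_
    filter_upwards [hball] with x hx
    rw [indicator_of_mem hx]

/-! ### The weighted inequalities on `Ω` -/

/-- For functions with zero trace, a positive solution on the open interval is enough. -/
theorem IsPosBesselSolution.lintegral_ball_le_of_trace_zero {n : ℕ} (hn : 1 ≤ n) {R lam α c : ℝ}
    (hR : 0 < R) (hα : 0 ≤ α) (hlam : 2 * α = (n : ℝ) - 2 - lam) {V W φ : ℝ → ℝ}
    (hV : IsHardyWeight R lam V) (hW : ContinuousOn W (Ioo 0 R)) (hW0 : ∀ r ∈ Ioo 0 R, 0 ≤ W r)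
    (hc : 0 ≤ c) (h : IsPosBesselSolution R c W φ)
    {u : EuclideanSpace ℝ (Fin n) → ℝ}
    {G : EuclideanSpace ℝ (Fin n) → EuclideanSpace ℝ (Fin n)}
    (hu : AEStronglyMeasurable u (volume.restrict (Metric.ball 0 R)))
    (hG : AEStronglyMeasurable G (volume.restrict (Metric.ball 0 R)))
    (hT : IsTrace R u G (fun _ => 0)) :
    ∫⁻ x in Metric.ball 0 R, ENNReal.ofReal
      (hardyDensity α V (fun r => c * W r) ‖x‖ * u x ^ 2) ≤
    ∫⁻ x in Metric.ball 0 R, ENNReal.ofReal (V ‖x‖ * ‖G x‖ ^ 2) := by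
  -- Truncate at `ρ k ↑ R`, regularise with `ε k ↓ 0`, and pass to the limit by Fatou's lemma.
  obtain ⟨ρ, -, hρ, hρlim⟩ := exists_seq_strictMono_tendsto' hR
  obtain ⟨ε, -, hε, hεlim⟩ := exists_seq_strictAnti_tendsto' (zero_lt_one (α := ℝ))
  set Q : ℕ → ℝ → ℝ := fun k => (Iio (ρ k)).indicator
    fun r => c * W r * (φ r / (φ r + ε k)) with hQ
  have hφc : ContinuousOn φ (Ioo 0 R) := h.contDiffOn.continuousOn
  have hQm : ∀ k, Measurable ((Ioo 0 R).indicator (Q k)) := fun k => by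
    have hcont : ContinuousOn (fun r => c * W r * (φ r / (φ r + ε k))) (Ioo 0 R) :=
      (continuousOn_const.mul hW).mul (hφc.div (hφc.add continuousOn_const)
        fun r hr => (add_pos (h.pos r hr) (hε k).1).ne')
    rw [hQ, indicator_indicator, inter_comm, ← indicator_indicator]
    exact (measurable_indicator_of_continuousOn measurableSet_Ioo hcont).indicator measurableSet_Iio
  have hVm : Measurable ((Ioo 0 R).indicator V) :=
    measurable_indicator_of_continuousOn measurableSet_Ioo
      (hV.continuousOn.mono Ioo_subset_Ioc_self)
  have hk : ∀ k, ∫⁻ x in Metric.ball 0 R, ENNReal.ofReal (hardyDensity α V (Q k) ‖x‖ * u x ^ 2) ≤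
      ∫⁻ x in Metric.ball 0 R, ENNReal.ofReal (V ‖x‖ * ‖G x‖ ^ 2) := fun k => by
    obtain ⟨κ, hκ, hH⟩ := h.exists_truncated_lintegral_le hn hα hlam hV hW hW0 hc (hρ k) (hε k).1
    have := lintegral_ball_le hn hR hκ hV (hQm k)
      (mem_of_superset (Ioo_mem_nhdsGT (hρ k).1) hH) hu hG hT
    simpa using this
  have hball := ae_norm_mem_Ioo_of_ball hn R
  have hmeas : ∀ k, AEMeasurable
      (fun x => ENNReal.ofReal (hardyDensity α V (Q k) ‖x‖ * u x ^ 2))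
      (volume.restrict (Metric.ball 0 R)) := fun k => by
    have hm : Measurable (hardyDensity α ((Ioo 0 R).indicator V) ((Ioo 0 R).indicator (Q k))) :=
      hVm.mul ((measurable_const.div (measurable_id.pow_const 2)).add (hQm k))
    refine AEMeasurable.congr ((hm.comp measurable_norm).aemeasurable.mul
      (hu.aemeasurable.pow_const 2)).ennreal_ofReal ?_
    filter_upwards [hball] with x hx
    simp only [Pi.mul_apply, Function.comp_apply, hardyDensity, indicator_of_mem hx]
  refine (lintegral_mono_ae ?_).trans ((lintegral_liminf_le' (u := atTop) hmeas).trans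
    (liminf_le_of_le (by isBoundedDefault) fun b hb => ?_))
  · filter_upwards [hball] with x hx
    have hlim : Tendsto (fun k => Q k ‖x‖) atTop (𝓝 (c * W ‖x‖)) := by
      have h0 := (h.pos _ hx).ne'
      have h1 : Tendsto (fun k => c * W ‖x‖ * (φ ‖x‖ / (φ ‖x‖ + ε k))) atTop
          (𝓝 (c * W ‖x‖ * (φ ‖x‖ / (φ ‖x‖ + 0)))) :=
        tendsto_const_nhds.mul (tendsto_const_nhds.div (tendsto_const_nhds.add hεlim) (by simpa))
      rw [add_zero, div_self h0, mul_one] at h1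
      refine h1.congr' ?_
      filter_upwards [hρlim.eventually_const_lt hx.2] with k hk
      simp only [hQ, indicator_of_mem (mem_Iio.2 hk)]
    exact ((ENNReal.continuous_ofReal.tendsto _).comp ((tendsto_const_nhds.mul
      (tendsto_const_nhds.add hlim)).mul tendsto_const_nhds)).liminf_eq.ge
  · obtain ⟨k, hbk⟩ := hb.exists
    exact hbk.trans (hk k)

theorem add_weightedMass_le {n : ℕ} (hn : 1 ≤ n) {Ω : Set (EuclideanSpace ℝ (Fin n))}
    (hΩ : MeasurableSet Ω) {R lam α c : ℝ} (hΩR : Ω ⊆ Metric.ball 0 R) {V W : ℝ → ℝ}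
    (hV : IsHardyWeight R lam V) (hW0 : ∀ r ∈ Ioo 0 R, 0 ≤ W r) (hc : 0 ≤ c)
    (u : EuclideanSpace ℝ (Fin n) → ℝ) :
    ENNReal.ofReal (α ^ 2) * weightedMass Ω (fun r => V r / r ^ 2) u
      + ENNReal.ofReal c * weightedMass Ω (fun r => V r * W r) u ≤
    ∫⁻ x in Metric.ball 0 R, ENNReal.ofReal
      (hardyDensity α V (fun r => c * W r) ‖x‖ * Ω.indicator u x ^ 2) := by
  have hball := ae_mono (Measure.restrict_mono hΩR le_rfl) (ae_norm_mem_Ioo_of_ball hn R)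
  calc _ ≤ ∫⁻ x in Ω, (ENNReal.ofReal (α ^ 2) * ENNReal.ofReal (V ‖x‖ / ‖x‖ ^ 2 * u x ^ 2) +
          ENNReal.ofReal c * ENNReal.ofReal (V ‖x‖ * W ‖x‖ * u x ^ 2)) :=
        (add_le_add (lintegral_const_mul_le _ _) (lintegral_const_mul_le _ _)).trans
          (le_lintegral_add _ _)
    _ = ∫⁻ x in Ω, ENNReal.ofReal
          (hardyDensity α V (fun r => c * W r) ‖x‖ * Ω.indicator u x ^ 2) := by
        refine lintegral_congr_ae ?_
        filter_upwards [hball, ae_restrict_mem hΩ] with x hx hxΩ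
        have hV0 := hV.pos _ (Ioo_subset_Ioc_self hx)
        have hWx := hW0 _ hx
        rw [indicator_of_mem hxΩ, ← ENNReal.ofReal_mul (by positivity),
          ← ENNReal.ofReal_mul hc, ← ENNReal.ofReal_add (by positivity) (by positivity)]
        congr 1
        simp only [hardyDensity]
        ring
    _ ≤ _ := lintegral_mono_set hΩR

theorem lintegral_indicator_energy_le {n : ℕ} {Ω : Set (EuclideanSpace ℝ (Fin n))}
    (hΩ : MeasurableSet Ω) (R : ℝ) (V : ℝ → ℝ)
    (G : EuclideanSpace ℝ (Fin n) → EuclideanSpace ℝ (Fin n)) :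
    ∫⁻ x in Metric.ball 0 R, ENNReal.ofReal (V ‖x‖ * ‖Ω.indicator G x‖ ^ 2) ≤
      weightedEnergy Ω V G := by
  rw [weightedEnergy, ← lintegral_indicator hΩ]
  refine (setLIntegral_le_lintegral _ _).trans (lintegral_mono fun x => ?_)
  by_cases hx : x ∈ Ω <;> simp [hx]

theorem isPosBesselSolution_one (R : ℝ) (W : ℝ → ℝ) : IsPosBesselSolution R 0 W (fun _ => 1) where
  contDiffOn := contDiffOn_const
  pos _ _ := one_pos
  ode r _ := by simp

theorem besselWeight_nonneg (R : ℝ) (W : ℝ → ℝ) : 0 ≤ besselWeight R W :=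
  Real.sSup_nonneg' ⟨0, ⟨_, isPosBesselSolution_one R W⟩, le_rfl⟩

theorem EReal.coe_ennreal_add_neg_le {X Y : ENNReal} {t : ℝ} (ht : 0 ≤ t)
    (h : X ≤ Y + ENNReal.ofReal t) : (X : EReal) + ((-t : ℝ) : EReal) ≤ (Y : EReal) := by
  rw [EReal.coe_neg, ← sub_eq_add_neg]
  refine EReal.sub_le_of_le_add ?_
  have := EReal.coe_ennreal_le_coe_ennreal_iff.2 h
  rwa [EReal.coe_ennreal_add, EReal.coe_ennreal_ofReal, max_eq_left ht] at this

theorem IsLUB.pos_of_isOpen_of_zero_mem {n : ℕ} (hn : 1 ≤ n) {Ω : Set (EuclideanSpace ℝ (Fin n))}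
    (hΩ : IsOpen Ω) (h0 : (0 : EuclideanSpace ℝ (Fin n)) ∈ Ω) {R : ℝ} (hR : IsLUB (norm '' Ω) R) :
    0 < R := by
  have : Nonempty (Fin n) := ⟨⟨0, hn⟩⟩
  obtain ⟨δ, hδ, hsub⟩ := Metric.isOpen_iff.1 hΩ 0 h0
  obtain ⟨x, hx⟩ := exists_norm_eq (EuclideanSpace ℝ (Fin n)) (half_pos hδ).le
  have hxΩ : x ∈ Ω := hsub (by rw [mem_ball_zero_iff, hx]; linarith)
  have := hR.1 (mem_image_of_mem norm hxΩ)
  linarith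

theorem IsLUB.subset_ball_of_isOpen {E : Type*} [NormedAddCommGroup E] [NormedSpace ℝ E]
    {Ω : Set E} (hΩ : IsOpen Ω) {R : ℝ} (hR0 : 0 < R) (hR : IsLUB (norm '' Ω) R) :
    Ω ⊆ Metric.ball 0 R := by
  have hsub : Ω ⊆ Metric.closedBall 0 R := fun x hx => by
    rw [mem_closedBall_zero_iff]
    exact hR.1 (mem_image_of_mem norm hx)
  have := interior_maximal hsub hΩ
  rwa [interior_closedBall _ hR0.ne'] at this

/-- The inequality with boundary term, for one constant `c ≥ 0` and a solution positive up to `R`. The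
coefficient of the boundary term is nonpositive, since `φ' ≤ 0` and `λ ≤ n - 2`. -/
theorem bessel_trace_inequality {n : ℕ} (hn : 1 ≤ n) {Ω : Set (EuclideanSpace ℝ (Fin n))}
    (hΩ : MeasurableSet Ω) {R lam : ℝ} (hR : 0 < R) (hΩR : Ω ⊆ Metric.ball 0 R)
    (hlam : lam ≤ (n : ℝ) - 2) {V W φ : ℝ → ℝ} (hV : IsHardyWeight R lam V)
    (hW : ContinuousOn W (Ioo 0 R)) (hW0 : ∀ r ∈ Ioo 0 R, 0 ≤ W r) {c : ℝ} (hc : 0 ≤ c)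
    (h : IsPosBesselSolutionUpTo R c W φ)
    {u T : EuclideanSpace ℝ (Fin n) → ℝ}
    {G : EuclideanSpace ℝ (Fin n) → EuclideanSpace ℝ (Fin n)}
    (huG : MemH1 (Metric.ball 0 R) (Ω.indicator u) (Ω.indicator G))
    (hT : IsTrace R (Ω.indicator u) (Ω.indicator G) T) :
    ((ENNReal.ofReal ((((n : ℝ) - lam - 2) / 2) ^ 2)
          * weightedMass Ω (fun r => V r / r ^ 2) u
        + ENNReal.ofReal c * weightedMass Ω (fun r => V r * W r) u : ENNReal) : EReal)
      + ((V R * (derivWithin φ (Ioc 0 R) R / φ R - ((n : ℝ) - lam - 2) / (2 * R))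
          * ∫ x, T x ^ 2 ∂(surfaceMeasure n R) : ℝ) : EReal)
      ≤ ((weightedEnergy Ω V G : ENNReal) : EReal) := by
  set α := ((n : ℝ) - lam - 2) / 2 with hα
  have hα0 : 0 ≤ α := div_nonneg (by linarith) two_pos.le
  have hlam' : 2 * α = (n : ℝ) - 2 - lam := by rw [hα]; ring
  set κ := V R * (α / R - derivWithin φ (Ioc 0 R) R / φ R) with hκdef
  have hκ : 0 ≤ κ := by
    refine mul_nonneg (hV.pos R ⟨hR, le_rfl⟩).le (sub_nonneg.2 ?_)
    exact (div_nonpos_of_nonpos_of_nonneg (h.derivWithin_nonpos hR hc hW0) h.pos_right.le).trans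
      (div_nonneg hα0 hR.le)
  have hI0 : 0 ≤ ∫ x, T x ^ 2 ∂(surfaceMeasure n R) := integral_nonneg fun _ => sq_nonneg _
  have hcoef : V R * (derivWithin φ (Ioc 0 R) R / φ R - ((n : ℝ) - lam - 2) / (2 * R))
      * ∫ x, T x ^ 2 ∂(surfaceMeasure n R) = -(κ * ∫ x, T x ^ 2 ∂(surfaceMeasure n R)) := by
    rw [hκdef, hα, div_div]
    ring
  rw [hcoef]
  refine EReal.coe_ennreal_add_neg_le (mul_nonneg hκ hI0) ?_
  rw [ENNReal.ofReal_mul hκ, ofReal_integral_eq_lintegral_ofReal hT.1.integrable_sq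
    (Eventually.of_forall fun _ => sq_nonneg _)]
  refine (add_weightedMass_le hn hΩ hΩR hV hW0 hc u).trans ((lintegral_ball_le hn hR hκ hV
    (measurable_indicator_of_continuousOn measurableSet_Ioo (continuousOn_const.mul hW)) ?_
    huG.memLp.1 huG.memLp_grad.1 hT).trans
      (add_le_add_left (lintegral_indicator_energy_le hΩ R V G) _))
  filter_upwards [Ioo_mem_nhdsGT hR] with a ha g hg
  exact h.lintegral_le hn hα0 hlam' hV hW hW0 hc ha hg

theorem mainTheorem3 (n : ℕ) (hn : 1 ≤ n)
    (Ω : Set (EuclideanSpace ℝ (Fin n))) (hΩ : IsOpen Ω) (h0 : (0 : EuclideanSpace ℝ (Fin n)) ∈ Ω)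
    (R : ℝ) (hR : IsLUB (norm '' Ω) R)
    (V : ℝ → ℝ) (hVpos : ∀ r ∈ Ioc 0 R, 0 < V r)
    (hVcont : ContinuousOn V (Ioc 0 R)) (hVdiff : ContDiffOn ℝ 1 V (Ioo 0 R))
    (lam : ℝ) (hlam : lam ≤ (n : ℝ) - 2)
    (hVnonneg : ∀ r ∈ Ioo 0 R, 0 ≤ r * deriv V r / V r + lam)
    (hVlim : Tendsto (fun r => r * deriv V r / V r + lam) (𝓝[>] 0) (𝓝 0))
    (W : ℝ → ℝ) (hW : IsBesselPotential R W) :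
    -- The inequality with the weight `β(W; R)` and a solution for `β(W; R) W`.
    (∀ φ : ℝ → ℝ, IsPosBesselSolutionUpTo R (besselWeight R W) W φ →
      ∀ (u : EuclideanSpace ℝ (Fin n) → ℝ)
        (G : EuclideanSpace ℝ (Fin n) → EuclideanSpace ℝ (Fin n))
        (T : EuclideanSpace ℝ (Fin n) → ℝ),
        MemH1 (Metric.ball 0 R) (Ω.indicator u) (Ω.indicator G) →
        IsTrace R (Ω.indicator u) (Ω.indicator G) T →
        ((ENNReal.ofReal ((((n : ℝ) - lam - 2) / 2) ^ 2)
              * weightedMass Ω (fun r => V r / r ^ 2) u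
            + ENNReal.ofReal (besselWeight R W) * weightedMass Ω (fun r => V r * W r) u
            : ENNReal) : EReal)
          + ((V R * (derivWithin φ (Ioc 0 R) R / φ R - ((n : ℝ) - lam - 2) / (2 * R))
              * ∫ x, T x ^ 2 ∂(surfaceMeasure n R) : ℝ) : EReal)
          ≤ ((weightedEnergy Ω V G : ENNReal) : EReal)) ∧
    -- The same for every constant `c ≥ 0` and every solution for `c W`.
    (∀ (c : ℝ), 0 ≤ c → ∀ φ : ℝ → ℝ, IsPosBesselSolutionUpTo R c W φ →
      ∀ (u : EuclideanSpace ℝ (Fin n) → ℝ)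
        (G : EuclideanSpace ℝ (Fin n) → EuclideanSpace ℝ (Fin n))
        (T : EuclideanSpace ℝ (Fin n) → ℝ),
        MemH1 (Metric.ball 0 R) (Ω.indicator u) (Ω.indicator G) →
        IsTrace R (Ω.indicator u) (Ω.indicator G) T →
        ((ENNReal.ofReal ((((n : ℝ) - lam - 2) / 2) ^ 2)
              * weightedMass Ω (fun r => V r / r ^ 2) u
            + ENNReal.ofReal c * weightedMass Ω (fun r => V r * W r) u
            : ENNReal) : EReal)
          + ((V R * (derivWithin φ (Ioc 0 R) R / φ R - ((n : ℝ) - lam - 2) / (2 * R))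
              * ∫ x, T x ^ 2 ∂(surfaceMeasure n R) : ℝ) : EReal)
          ≤ ((weightedEnergy Ω V G : ENNReal) : EReal)) ∧
    -- For functions with zero trace: the weight `β(W; R)`, whether or not a solution is positive
    -- at `R`.
    (∀ (u : EuclideanSpace ℝ (Fin n) → ℝ)
        (G : EuclideanSpace ℝ (Fin n) → EuclideanSpace ℝ (Fin n)),
        MemH1 (Metric.ball 0 R) (Ω.indicator u) (Ω.indicator G) →
        IsTrace R (Ω.indicator u) (Ω.indicator G) (fun _ => 0) →
        ENNReal.ofReal ((((n : ℝ) - lam - 2) / 2) ^ 2)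
              * weightedMass Ω (fun r => V r / r ^ 2) u
            + ENNReal.ofReal (besselWeight R W) * weightedMass Ω (fun r => V r * W r) u
          ≤ weightedEnergy Ω V G) := by
  have hR0 : 0 < R := IsLUB.pos_of_isOpen_of_zero_mem hn hΩ h0 hR
  have hΩR : Ω ⊆ Metric.ball 0 R := IsLUB.subset_ball_of_isOpen hΩ hR0 hR
  have hV : IsHardyWeight R lam V := ⟨hVpos, hVcont, hVdiff, hVnonneg⟩
  refine ⟨fun φ hφ u G T huG hT => ?_, fun c hc φ hφ u G T huG hT => ?_, fun u G huG hT => ?_⟩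
  · exact bessel_trace_inequality hn hΩ.measurableSet hR0 hΩR hlam hV hW.continuousOn hW.nonneg
      (besselWeight_nonneg R W) hφ huG hT
  · exact bessel_trace_inequality hn hΩ.measurableSet hR0 hΩR hlam hV hW.continuousOn hW.nonneg
      hc hφ huG hT
  have hc : ∀ c : ℝ, 0 ≤ c → (∃ φ, IsPosBesselSolution R c W φ) →
      ENNReal.ofReal ((((n : ℝ) - lam - 2) / 2) ^ 2) * weightedMass Ω (fun r => V r / r ^ 2) u
        + ENNReal.ofReal c * weightedMass Ω (fun r => V r * W r) u ≤ weightedEnergy Ω V G := by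
    rintro c hc ⟨φ, hφ⟩
    exact (add_weightedMass_le hn hΩ.measurableSet hΩR hV hW.nonneg hc u).trans
      ((hφ.lintegral_ball_le_of_trace_zero hn hR0 (div_nonneg (by linarith) two_pos.le) (by ring)
        hV hW.continuousOn hW.nonneg hc huG.memLp.1 huG.memLp_grad.1 hT).trans
        (lintegral_indicator_energy_le hΩ.measurableSet R V G))
  obtain ⟨c₀, hc₀, hsol⟩ := hW.exists_solution
  by_cases hbdd : BddAbove {c : ℝ | ∃ φ : ℝ → ℝ, IsPosBesselSolution R c W φ}
  · have hβ : 0 < besselWeight R W := hc₀.trans_le (le_csSup hbdd hsol)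
    obtain ⟨c, -, hclim, hcS⟩ := exists_seq_tendsto_sSup ⟨c₀, hsol⟩ hbdd
    -- The supremum need not be attained; it is a limit of constants for which a solution exists.
    refine le_of_tendsto (tendsto_const_nhds.add (ENNReal.Tendsto.mul_const
      ((ENNReal.continuous_ofReal.tendsto _).comp hclim)
      (Or.inl (ENNReal.ofReal_pos.2 hβ).ne'))) ?_
    filter_upwards [hclim.eventually_const_lt hβ] with k hk
    exact hc _ hk.le (hcS k)
  · -- The supremum of an unbounded set is `0`, and the inequality holds with `c = 0`.
    rw [besselWeight, Real.sSup_of_not_bddAbove hbdd]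
    exact hc 0 le_rfl ⟨_, isPosBesselSolution_one R W⟩
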